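/- For positive integers $n$ and real $w$ let $B_{2n}(w)$ be the set of nonzero vectors of $\{0,1\}^{2n}$ of Hamming weight at most $w$. A binary double circulant code is a linear code of length $2n$ over $\mathbb F_2$ with a parity-check matrix of the form $[\mathbf I_n\,|\,\mathbf A]$, where $\mathbf I_n$ is the $n\times n$ identity matrix and $\mathbf A=(a_{i-j \bmod n})_{0\le i,j<n}$ is a circulant matrix over $\mathbb F_2$. Call a prime $p$ suitable if $p\ge q:=14^3$, $2$ is primitive modulo $p$ (that is, $2$ has multiplicative order $p-1$ modulo $p$), and $2^{p-1}\not\equiv 1 \pmod{p^2}$. Theorem. Let $0<b\le 0.23$. For every suitable prime $p$, every power $n=p^m$ ($m\ge 0$) of $p$, and every real number $w$ with $|B_{2n}(w)|\le b\,n\,2^n$, there exists a binary double circulant code of length $2n$, dimension $n$ and minimum distance $d>w$. Moreover, the smallest suitable prime is $2789$. -/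

import Mathlib

namespace DoubleCirculant

/-- A prime `p` such that `2` is primitive modulo `p` (it generates the cyclic group of order
`p - 1` of invertible residues) and `2 ^ (p - 1)` is not congruent to `1` modulo `p ^ 2`. -/
def IsKasamiPrime (p : ℕ) : Prop :=
  p.Prime ∧ orderOf (2 : ZMod p) = p - 1 ∧ ¬ 2 ^ (p - 1) ≡ 1 [MOD p ^ 2]

/-- The space of binary vectors `x = (x_L, x_R)` of length `2n`; the `2n` coordinate positions are
`Fin n ⊕ Fin n`, left half and right half. -/
abbrev V (n : ℕ) : Type := Fin n ⊕ Fin n → ZMod 2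

/-- `B_{2n}(w)`: the nonzero binary vectors of length `2n` of Hamming weight at most `w`, for a
real number `w`. -/
def B (n : ℕ) (w : ℝ) : Set (V n) :=
  {x | x ≠ 0 ∧ (hammingNorm x : ℝ) ≤ w}

/-- The parity-check matrix `[I | A]`, where `A` is the circulant matrix with entries
`A i j = a (i - j)`, indices being taken modulo `n` (so the first column of `A` is `a`). -/
def parityCheck {n : ℕ} (a : Fin n → ZMod 2) : Matrix (Fin n) (Fin n ⊕ Fin n) (ZMod 2) :=
  Matrix.fromCols 1 (Matrix.circulant a)

/-- A binary linear code of length `2n` is double circulant if it has a parity-check matrix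
`[I | A]` with `A` circulant. -/
def IsDoubleCirculant {n : ℕ} (C : Submodule (ZMod 2) (V n)) : Prop :=
  ∃ a : Fin n → ZMod 2, ∀ x : V n, x ∈ C ↔ (parityCheck a).mulVec x = 0

/-- `d` is the minimum distance of `C`: the least Hamming distance between distinct codewords. -/
def IsMinDist {n : ℕ} (C : Submodule (ZMod 2) (V n)) (d : ℕ) : Prop :=
  IsLeast {k : ℕ | ∃ x ∈ C, ∃ y ∈ C, x ≠ y ∧ hammingDist x y = k} d

/-- `C` is a `[2n, k, d]` code: a linear code of length `2n`, dimension `k` and minimum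
distance `d`. -/
def HasParameters {n : ℕ} (C : Submodule (ZMod 2) (V n)) (k d : ℕ) : Prop :=
  Module.finrank (ZMod 2) C = k ∧ IsMinDist C d

end DoubleCirculant

set_option linter.unusedSectionVars false

namespace DoubleCirculant

open Polynomial Finset

/-! ### Primitivity of `2` modulo prime powers -/

lemma IsKasamiPrime.two_lt {p : ℕ} (hp : IsKasamiPrime p) : 2 < p := by
  obtain ⟨h1, h2, _⟩ := hp
  refine lt_of_le_of_ne h1.two_le ?_
  rintro rfl
  have h := pow_orderOf_eq_one (2 : ZMod 2)
  rw [h2] at h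
  exact absurd h (by decide)

lemma IsKasamiPrime.odd {p : ℕ} (hp : IsKasamiPrime p) : Odd p :=
  hp.1.odd_of_ne_two hp.two_lt.ne'

/-- Lifting the exponent: the p-adic valuation of 2^((p-1)c) - 1 is that of 2^(p-1) - 1, which is at
most 1 by the condition modulo p², plus that of c. -/
lemma IsKasamiPrime.dvd_of_two_pow_eq_one {p : ℕ} (hp : IsKasamiPrime p) {i k : ℕ} (hk : k ≠ 0)
    (h : p ^ (i + 1) ∣ 2 ^ k - 1) : p ^ i * (p - 1) ∣ k := by
  have : Fact p.Prime := ⟨hp.1⟩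
  have h2p := hp.two_lt
  have hp1 : p ∣ 2 ^ k - 1 := (dvd_pow_self p (Nat.succ_ne_zero i)).trans h
  have hone : ∀ k : ℕ, p ∣ 2 ^ k - 1 ↔ p - 1 ∣ k := by
    intro k
    rw [← hp.2.1, orderOf_dvd_iff_pow_eq_one, ← ZMod.natCast_eq_zero_iff,
      Nat.cast_sub Nat.one_le_two_pow, sub_eq_zero]
    push_cast
    rfl
  obtain ⟨c, rfl⟩ := (hone k).1 hp1
  have hc : c ≠ 0 := by rintro rfl; simp at hk
  have h2 : ¬ p ∣ 2 ^ (p - 1) := fun hd =>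
    absurd (Nat.le_of_dvd two_pos (hp.1.dvd_of_dvd_pow hd)) (by omega)
  have hgt : 1 < 2 ^ (p - 1) := Nat.one_lt_two_pow (by omega)
  have hlte := padicValNat.pow_sub_pow (p := p) hp.odd hgt ((hone (p - 1)).2 dvd_rfl) h2 hc
  have hv : padicValNat p (2 ^ (p - 1) - 1) ≤ 1 := by
    by_contra! hcon
    refine hp.2.2 ?_
    exact ((Nat.modEq_iff_dvd' hgt.le).2
      ((padicValNat_dvd_iff_le (Nat.sub_ne_zero_of_lt hgt)).2 hcon)).symm
  rw [one_pow, ← pow_mul] at hlte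
  have hne : 2 ^ ((p - 1) * c) - 1 ≠ 0 := Nat.sub_ne_zero_of_lt (Nat.one_lt_two_pow hk)
  have hle := (padicValNat_dvd_iff_le hne).1 h
  have : p ^ i ∣ c := (padicValNat_dvd_iff_le hc).2 (by omega)
  rw [mul_comm]
  exact mul_dvd_mul_left _ this

/-- Over F₂ the irreducible factors of Φ_N, N odd, have degree the order of 2 modulo N, which here
is the full degree φ(N). -/
lemma IsKasamiPrime.irreducible_cyclotomic {p : ℕ} (hp : IsKasamiPrime p) (i : ℕ) :
    Irreducible (cyclotomic (p ^ (i + 1)) (ZMod 2)) := by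
  have h2 : ¬ 2 ∣ p ^ (i + 1) := fun h => by
    have := Nat.prime_two.dvd_of_dvd_pow h
    have h3 := hp.odd
    rw [← Nat.not_even_iff_odd] at h3
    exact h3 (even_iff_two_dvd.2 this)
  refine ZMod.irreducible_of_dvd_cyclotomic_of_natDegree h2 dvd_rfl ?_
  rw [natDegree_cyclotomic]
  set u := ZMod.unitOfCoprime 2 (Nat.prime_two.coprime_iff_not_dvd.mpr h2) with hu
  have : NeZero (p ^ (i + 1)) := ⟨pow_ne_zero _ hp.1.ne_zero⟩
  refine dvd_antisymm ?_ ?_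
  · rw [Nat.totient_prime_pow_succ hp.1]
    refine hp.dvd_of_two_pow_eq_one (orderOf_pos u).ne' ?_
    rw [← ZMod.natCast_eq_zero_iff, Nat.cast_sub Nat.one_le_two_pow, sub_eq_zero]
    have h1 := congrArg Units.val (pow_orderOf_eq_one u)
    rw [Units.val_pow_eq_pow_val, Units.val_one, hu, ZMod.coe_unitOfCoprime, ← hu] at h1
    exact_mod_cast h1
  · exact orderOf_dvd_of_pow_eq_one (ZMod.pow_totient u)

/-! ### The smallest suitable prime -/

lemma orderOf_two_ne {p k : ℕ} (hk : 0 < k) (hkp : k < p - 1) (h : 2 ^ k % p = 1 % p) :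
    orderOf (2 : ZMod p) ≠ p - 1 := by
  intro ho
  have : (2 : ZMod p) ^ k = 1 := by
    have := (ZMod.natCast_eq_natCast_iff' (2 ^ k) 1 p).2 h
    simpa using this
  have := Nat.le_of_dvd hk (orderOf_dvd_of_pow_eq_one this)
  omega

set_option exponentiation.threshold 3000 in
lemma isKasamiPrime_2789 : IsKasamiPrime 2789 := by
  refine ⟨by norm_num, ?_, ?_⟩
  · have key : ∀ k, (2 : ZMod 2789) ^ k = 1 ↔ 2 ^ k % 2789 = 1 % 2789 := fun k => by
      rw [← ZMod.natCast_eq_natCast_iff' (2 ^ k) 1 2789]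
      simp
    refine orderOf_eq_of_pow_and_pow_div_prime (by norm_num) ?_ ?_
    · rw [key]; norm_num
    · intro q hq hd
      rw [Ne, key]
      have h : q ∣ 2 ^ 2 * 17 * 41 := by norm_num at hd ⊢; exact hd
      have h2 : q = 2 ∨ q = 17 ∨ q = 41 := by
        rcases (hq.dvd_mul).1 h with h | h
        · rcases (hq.dvd_mul).1 h with h | h
          · exact Or.inl ((Nat.prime_dvd_prime_iff_eq hq Nat.prime_two).1 (hq.dvd_of_dvd_pow h))
          · exact Or.inr (Or.inl ((Nat.prime_dvd_prime_iff_eq hq (by norm_num)).1 h))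
        · exact Or.inr (Or.inr ((Nat.prime_dvd_prime_iff_eq hq (by norm_num)).1 h))
      rcases h2 with rfl | rfl | rfl <;> norm_num
  · rw [Nat.ModEq]
    norm_num

set_option exponentiation.threshold 3000 in
lemma isLeast_kasamiPrime : IsLeast {p : ℕ | IsKasamiPrime p ∧ 14 ^ 3 ≤ p} 2789 := by
  refine ⟨⟨isKasamiPrime_2789, by norm_num⟩, ?_⟩
  rintro p ⟨⟨hp, ho, -⟩, hge⟩
  by_contra! hlt
  norm_num at hge
  -- These are the only primes in the range. The exponents used below are (p-1)/3, (p-1)/2, (p-1)/6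
  -- and (p-1)/2.
  have h : p = 2749 ∨ p = 2753 ∨ p = 2767 ∨ p = 2777 := by
    interval_cases p <;> first | (exfalso; revert hp; norm_num; done) | simp
  rcases h with rfl | rfl | rfl | rfl
  · exact orderOf_two_ne (k := 916) (by norm_num) (by norm_num) (by norm_num) ho
  · exact orderOf_two_ne (k := 1376) (by norm_num) (by norm_num) (by norm_num) ho
  · exact orderOf_two_ne (k := 461) (by norm_num) (by norm_num) (by norm_num) ho
  · exact orderOf_two_ne (k := 1388) (by norm_num) (by norm_num) (by norm_num) ho

/-! ### Polynomials acting on periodic sequences -/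

/-- The cyclic shift on binary sequences indexed by `ZMod q`. -/
def shift (q : ℕ) : Module.End (ZMod 2) (ZMod q → ZMod 2) :=
  LinearMap.funLeft (ZMod 2) (ZMod 2) (fun i => i - 1)

/-- The polynomial `∑ v i * X ^ i` attached to a cyclic vector. -/
noncomputable def vecPoly {n : ℕ} [NeZero n] (v : ZMod n → ZMod 2) : (ZMod 2)[X] :=
  ∑ i : ZMod n, C (v i) * X ^ i.val

/-- Membership of `v = (x, y)` in the code with parity-check matrix `[I | circulant a]`. -/
def InCode {n : ℕ} [NeZero n] (a : ZMod n → ZMod 2) (v : ZMod n ⊕ ZMod n → ZMod 2) : Prop :=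
  ∀ i, v (.inl i) + ∑ j, a (i - j) * v (.inr j) = 0

/-- The sums of the entries of `f` over the residue classes modulo `q`. -/
def fold {n : ℕ} [NeZero n] (q : ℕ) (f : ZMod n → ZMod 2) (c : ZMod q) : ZMod 2 :=
  ∑ i : ZMod n, if (i.val : ZMod q) = c then f i else 0

lemma shift_pow_apply (q k : ℕ) (f : ZMod q → ZMod 2) (i : ZMod q) :
    (shift q ^ k) f i = f (i - k) := by
  induction k generalizing f i with
  | zero => simp
  | succ k ih =>
    rw [pow_succ, Module.End.mul_apply, ih]
    simp only [shift, LinearMap.funLeft_apply]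
    congr 1
    push_cast
    ring

lemma aeval_shift_X_pow_sub_one (q : ℕ) : aeval (shift q) (X ^ q - 1 : (ZMod 2)[X]) = 0 := by
  ext f i
  simp [shift_pow_apply]

lemma aeval_shift_eq_zero {q : ℕ} {P : (ZMod 2)[X]} (h : X ^ q - 1 ∣ P) :
    aeval (shift q) P = 0 := by
  obtain ⟨Q, rfl⟩ := h
  rw [map_mul, aeval_shift_X_pow_sub_one, zero_mul]

lemma sum_zmod_val {M : Type*} [AddCommMonoid M] (n : ℕ) [NeZero n] (g : ℕ → M) :
    ∑ i : ZMod n, g i.val = ∑ k ∈ range n, g k := by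
  cases n with
  | zero => exact absurd rfl (NeZero.ne 0)
  | succ n => exact Fin.sum_univ_eq_sum_range g (n + 1)

section

variable {n : ℕ} [NeZero n]

lemma aeval_vecPoly (q : ℕ) (v : ZMod n → ZMod 2) (f : ZMod q → ZMod 2) (c : ZMod q) :
    aeval (shift q) (vecPoly v) f c = ∑ i, v i * f (c - (i.val : ZMod q)) := by
  simp only [vecPoly, map_sum, map_mul, aeval_C, map_pow, aeval_X, LinearMap.sum_apply,
    Finset.sum_apply]
  refine Finset.sum_congr rfl fun i _ => ?_
  rw [Module.End.mul_apply, Module.algebraMap_end_apply, Pi.smul_apply, shift_pow_apply,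
    smul_eq_mul]

/-- Acting on the delta at 0 amounts to reducing a polynomial modulo X^q - 1, so divisibility
statements become statements about sums over residue classes. -/
lemma aeval_vecPoly_single (q : ℕ) (v : ZMod n → ZMod 2) :
    aeval (shift q) (vecPoly v) (Pi.single 0 1) = fold q v := by
  ext c
  rw [aeval_vecPoly, fold]
  refine Finset.sum_congr rfl fun i _ => ?_
  rw [Pi.single_apply]
  by_cases h : (i.val : ZMod q) = c
  · simp [h]
  · rw [if_neg h, if_neg (fun h' => h (sub_eq_zero.1 h').symm), mul_zero]

lemma fold_self (v : ZMod n → ZMod 2) : fold n v = v := by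
  ext c
  simp [fold]

lemma coeff_vecPoly (v : ZMod n → ZMod 2) (k : ℕ) :
    (vecPoly v).coeff k = if k < n then v k else 0 := by
  have h : vecPoly v = ∑ k ∈ range n, C (v (k : ZMod n)) * X ^ k := by
    rw [← sum_zmod_val n fun k => C (v (k : ZMod n)) * X ^ k]
    simp [vecPoly]
  rw [h]
  simp [coeff_C_mul, coeff_X_pow]

lemma vecPoly_sub (v v' : ZMod n → ZMod 2) : vecPoly v - vecPoly v' = vecPoly (v - v') := by
  simp [vecPoly, sub_mul]

lemma vecPoly_eq_zero {v : ZMod n → ZMod 2} (h : vecPoly v = 0) : v = 0 := by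
  ext i
  have := coeff_vecPoly v i.val
  rw [h, if_pos i.val_lt] at this
  simpa using this.symm

lemma monic_X_pow_sub_one (n : ℕ) [NeZero n] : (X ^ n - 1 : (ZMod 2)[X]).Monic := by
  simpa using monic_X_pow_sub_C (1 : ZMod 2) (NeZero.ne n)

lemma natDegree_X_pow_sub_one (n : ℕ) : (X ^ n - 1 : (ZMod 2)[X]).natDegree = n := by
  simpa using natDegree_X_pow_sub_C (R := ZMod 2) (n := n) (r := 1)

lemma exists_vecPoly_of_degree_lt {P : (ZMod 2)[X]} (h : P.degree < n) :
    ∃ v : ZMod n → ZMod 2, P = vecPoly v := by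
  refine ⟨fun i => P.coeff i.val, ?_⟩
  ext k
  rw [coeff_vecPoly]
  split_ifs with hk
  · rw [ZMod.val_natCast, Nat.mod_eq_of_lt hk]
  · exact coeff_eq_zero_of_degree_lt (h.trans_le (by exact_mod_cast not_lt.1 hk))

lemma X_pow_sub_one_dvd {P : (ZMod 2)[X]} (h : aeval (shift n) P (Pi.single 0 1) = 0) :
    X ^ n - 1 ∣ P := by
  have hm := monic_X_pow_sub_one n
  have hdeg : (P %ₘ (X ^ n - 1)).degree < n := by
    have := degree_modByMonic_lt P hm
    rwa [degree_eq_natDegree hm.ne_zero, natDegree_X_pow_sub_one] at this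
  obtain ⟨v, hv⟩ := exists_vecPoly_of_degree_lt hdeg
  rw [← modByMonic_add_div P (X ^ n - 1), map_add, map_mul, aeval_shift_X_pow_sub_one, zero_mul,
    add_zero, hv, aeval_vecPoly_single, fold_self] at h
  rw [← modByMonic_eq_zero_iff_dvd hm, hv, h]
  simp [vecPoly]

lemma InCode.dvd {a : ZMod n → ZMod 2} {v : ZMod n ⊕ ZMod n → ZMod 2} (h : InCode a v) :
    X ^ n - 1 ∣ vecPoly (v ∘ Sum.inl) + vecPoly a * vecPoly (v ∘ Sum.inr) := by
  refine X_pow_sub_one_dvd ?_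
  ext c
  rw [map_add, map_mul, LinearMap.add_apply, Module.End.mul_apply, aeval_vecPoly_single,
    aeval_vecPoly_single, fold_self, fold_self, Pi.add_apply, aeval_vecPoly, Pi.zero_apply,
    ← h c, Function.comp_apply]
  congr 1
  refine Fintype.sum_equiv (Equiv.subLeft c) _ _ fun j => ?_
  simp

lemma card_inCode_le_of_isCoprime (v : ZMod n ⊕ ZMod n → ZMod 2) {G H : (ZMod 2)[X]}
    (hGH : G * H = X ^ n - 1) (hcop : IsCoprime G (vecPoly (v ∘ Sum.inr))) :
    Nat.card {a : ZMod n → ZMod 2 // InCode a v} ≤ 2 ^ (n - G.natDegree) := by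
  have hcard : Nat.card (Fin (n - G.natDegree) → ZMod 2) = 2 ^ (n - G.natDegree) := by simp
  rw [← hcard]
  refine Nat.card_le_card_of_injective
    (fun a k => a.1 ((G.natDegree + k : ℕ) : ZMod n)) fun a b hab => Subtype.ext ?_
  have hG0 : G ≠ 0 := by
    rintro rfl
    rw [zero_mul] at hGH
    exact (monic_X_pow_sub_one n).ne_zero hGH.symm
  have hdvd : G ∣ vecPoly (a.1 - b.1) := by
    have h1 := dvd_sub a.2.dvd b.2.dvd
    rw [add_sub_add_left_eq_sub, ← sub_mul, vecPoly_sub, ← hGH] at h1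
    exact hcop.dvd_of_dvd_mul_right ((dvd_mul_right G H).trans h1)
  have h0 := eq_zero_of_dvd_of_degree_lt hdvd <| by
    rw [degree_eq_natDegree hG0, degree_lt_iff_coeff_zero]
    intro k hk
    rw [coeff_vecPoly]
    split_ifs with hkn
    · have := congrFun hab ⟨k - G.natDegree, by omega⟩
      simp only [Nat.add_sub_of_le hk] at this
      rw [Pi.sub_apply, this, sub_self]
    · rfl
  exact sub_eq_zero.1 (vecPoly_eq_zero h0)

end

/-! ### The factorisation of X^(p^m) - 1 and the number of columns admitting a vector. -/

lemma prod_cyclotomic_mul {p : ℕ} (hp : p.Prime) {M m : ℕ} (h : M ≤ m) :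
    (∏ i ∈ Ico M m, cyclotomic (p ^ (i + 1)) (ZMod 2)) * (X ^ p ^ M - 1) = X ^ p ^ m - 1 := by
  have : Fact p.Prime := ⟨hp⟩
  induction m, h using Nat.le_induction with
  | base => simp
  | succ m hm ih =>
    rw [prod_Ico_succ_top hm, mul_right_comm, ih, mul_comm, cyclotomic_prime_pow_mul_X_pow_sub_one]

lemma cyclotomic_dvd_X_pow_sub_one {p m : ℕ} (hp : p.Prime) {M : ℕ} (h : M < m) :
    cyclotomic (p ^ (M + 1)) (ZMod 2) ∣ X ^ p ^ m - 1 := by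
  rw [← prod_cyclotomic_mul hp h.le]
  exact dvd_mul_of_dvd_left (dvd_prod_of_mem _ (mem_Ico.2 ⟨le_rfl, h⟩)) _

section

variable {p m : ℕ} [NeZero (p ^ m)]

lemma card_inCode_le (hp : IsKasamiPrime p) {M : ℕ} (hM : M ≤ m)
    (v : ZMod (p ^ m) ⊕ ZMod (p ^ m) → ZMod 2)
    (h : ∀ i, M ≤ i → i < m →
      ¬ cyclotomic (p ^ (i + 1)) (ZMod 2) ∣ vecPoly (v ∘ Sum.inr)) :
    Nat.card {a : ZMod (p ^ m) → ZMod 2 // InCode a v} ≤ 2 ^ p ^ M := by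
  have hGH := prod_cyclotomic_mul hp.1 hM
  refine (card_inCode_le_of_isCoprime v hGH (IsCoprime.prod_left fun i hi => ?_)).trans_eq ?_
  · rw [mem_Ico] at hi
    exact ((hp.irreducible_cyclotomic i).coprime_iff_not_dvd).2 (h i hi.1 hi.2)
  · have : NeZero (p ^ M) := ⟨pow_ne_zero _ hp.1.ne_zero⟩
    have hdeg := congrArg natDegree hGH
    rw [natDegree_mul (prod_ne_zero_iff.2 fun i _ => cyclotomic_ne_zero _ _)
      (monic_X_pow_sub_one _).ne_zero, natDegree_X_pow_sub_one, natDegree_X_pow_sub_one] at hdeg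
    congr 1
    omega

lemma InCode.cyclotomic_dvd (hp : p.Prime) {M : ℕ} (hM : M < m) {a : ZMod (p ^ m) → ZMod 2}
    {v : ZMod (p ^ m) ⊕ ZMod (p ^ m) → ZMod 2} (hv : InCode a v)
    (h : cyclotomic (p ^ (M + 1)) (ZMod 2) ∣ vecPoly (v ∘ Sum.inr)) :
    cyclotomic (p ^ (M + 1)) (ZMod 2) ∣ vecPoly (v ∘ Sum.inl) :=
  (dvd_add_left (h.mul_left _)).1 ((cyclotomic_dvd_X_pow_sub_one hp hM).trans hv.dvd)

/-- Since Φ_{p^(M+1)} (X^(p^M) - 1) = X^(p^(M+1)) - 1, multiplication by X^(p^M) - 1 kills f modulo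
X^(p^(M+1)) - 1, and the coefficients of f modulo the latter are its folds. -/
lemma fold_sub_eq_of_cyclotomic_dvd (hp : p.Prime) {M : ℕ} {f : ZMod (p ^ m) → ZMod 2}
    (h : cyclotomic (p ^ (M + 1)) (ZMod 2) ∣ vecPoly f) (c : ZMod (p ^ (M + 1))) :
    fold (p ^ (M + 1)) f (c - (p ^ M : ℕ)) = fold (p ^ (M + 1)) f c := by
  have : Fact p.Prime := ⟨hp⟩
  have hd : X ^ p ^ (M + 1) - 1 ∣ (X ^ p ^ M - 1) * vecPoly f := by
    rw [← cyclotomic_prime_pow_mul_X_pow_sub_one, mul_comm]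
    exact mul_dvd_mul_left _ h
  have h0 := congrArg (fun T => T (Pi.single 0 1) c) (aeval_shift_eq_zero hd)
  simp only [map_mul, map_sub, map_pow, aeval_X, map_one, Module.End.mul_apply,
    aeval_vecPoly_single, LinearMap.sub_apply, Pi.sub_apply, shift_pow_apply,
    Module.End.one_apply, LinearMap.zero_apply, Pi.zero_apply] at h0
  exact sub_eq_zero.1 h0

end

/-! ### Swapping the pairs of a partial matching of the coordinates -/

section Matching

variable {I E : Type*}

/-- Exchange the two copies of every `e` with `P e ≠ 0`. -/
def pairSwap (P : E → ZMod 2) : Equiv.Perm (E ⊕ E) :=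
  Function.Involutive.toPerm
    (Sum.elim (fun e => if P e = 0 then .inl e else .inr e)
      (fun e => if P e = 0 then .inr e else .inl e))
    (by
      rintro (e | e) <;> by_cases h : P e = 0 <;> simp [h])

/-- The permutation of the coordinates exchanging `l e` and `r e` whenever `P e ≠ 0`. -/
noncomputable def matchPerm (l r : E → I) (hlr : Function.Injective (Sum.elim l r))
    (P : E → ZMod 2) : Equiv.Perm I :=
  (pairSwap P).viaEmbedding ⟨Sum.elim l r, hlr⟩

lemma matchPerm_left {l r : E → I} (hlr : Function.Injective (Sum.elim l r))
    (P : E → ZMod 2) (e : E) :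
    matchPerm l r hlr P (l e) = if P e = 0 then l e else r e := by
  have := (pairSwap P).viaEmbedding_apply ⟨Sum.elim l r, hlr⟩ (.inl e)
  rw [matchPerm]
  refine this.trans ?_
  by_cases h : P e = 0 <;> simp [pairSwap, Function.Involutive.toPerm, h]

lemma matchPerm_right {l r : E → I} (hlr : Function.Injective (Sum.elim l r))
    (P : E → ZMod 2) (e : E) :
    matchPerm l r hlr P (r e) = if P e = 0 then r e else l e := by
  have := (pairSwap P).viaEmbedding_apply ⟨Sum.elim l r, hlr⟩ (.inr e)
  rw [matchPerm]
  refine this.trans ?_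
  by_cases h : P e = 0 <;> simp [pairSwap, Function.Involutive.toPerm, h]

lemma matchPerm_of_notMem {l r : E → I} (hlr : Function.Injective (Sum.elim l r))
    (P : E → ZMod 2) {i : I} (hl : ∀ e, l e ≠ i) (hr : ∀ e, r e ≠ i) :
    matchPerm l r hlr P i = i := by
  refine (pairSwap P).viaEmbedding_apply_of_notMem ⟨Sum.elim l r, hlr⟩ i ?_
  rintro ⟨e | e, h⟩
  · exact hl e h
  · exact hr e h

lemma left_ne_right {l r : E → I} (hlr : Function.Injective (Sum.elim l r)) 
    (e e' : E) : l e ≠ r e' := fun h => by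
  have := @hlr (.inl e) (.inr e') h
  simp at this

lemma left_injective {l r : E → I} (hlr : Function.Injective (Sum.elim l r)) :
    Function.Injective l := fun e e' h => by
  simpa using @hlr (.inl e) (.inl e') h

lemma right_injective {l r : E → I} (hlr : Function.Injective (Sum.elim l r)) :
    Function.Injective r := fun e e' h => by
  simpa using @hlr (.inr e) (.inr e') h

variable [Fintype I] [DecidableEq I] [Fintype E] [DecidableEq E]

open Classical in
/-- The nonzero binary vectors of Hamming weight at most `w`. -/
noncomputable def ball (I : Type*) [Fintype I] [DecidableEq I] (w : ℝ) : Finset (I → ZMod 2) :=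
  {x | x ≠ 0 ∧ (hammingNorm x : ℝ) ≤ w}

lemma mem_ball {w : ℝ} {x : I → ZMod 2} : x ∈ ball I w ↔ x ≠ 0 ∧ (hammingNorm x : ℝ) ≤ w := by
  simp [ball]

lemma hammingNorm_comp_equiv {I J : Type*} [Fintype I] [Fintype J] (π : J ≃ I)
    (x : I → ZMod 2) : hammingNorm (x ∘ π) = hammingNorm x := by
  rw [hammingNorm, hammingNorm]
  refine Finset.card_bij (fun i _ => π i) (by simp) (fun _ _ _ _ h => π.injective h) ?_
  intro b hb
  exact ⟨π.symm b, by simpa using hb, by simp⟩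

lemma comp_perm_mem_ball (π : Equiv.Perm I) {w : ℝ} {x : I → ZMod 2} :
    x ∘ π ∈ ball I w ↔ x ∈ ball I w := by
  rw [mem_ball, mem_ball, hammingNorm_comp_equiv]
  refine and_congr_left fun _ => not_congr ⟨fun h => ?_, fun h => by rw [h]; rfl⟩
  ext i
  simpa using congrFun h (π.symm i)

lemma apply_matchPerm {l r : E → I} (hlr : Function.Injective (Sum.elim l r))
    (x : I → ZMod 2) (P : E → ZMod 2) (i : I) :
    x (matchPerm l r hlr P i) = x i + ∑ e, P e * (x (l e) + x (r e)) *
      ((if l e = i then 1 else 0) + if r e = i then 1 else 0) := by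
  have key : ∀ s t u : ZMod 2, (if s = 0 then t else u) = t + s * (t + u) := by decide
  by_cases hl : ∃ e, l e = i
  · obtain ⟨e, rfl⟩ := hl
    rw [matchPerm_left, apply_ite x, key, Finset.sum_eq_single e]
    · simp [(left_ne_right hlr e e).symm]
    · intro e' _ he
      simp [(left_injective hlr).ne he, (left_ne_right hlr e e').symm]
    · simp
  · by_cases hr : ∃ e, r e = i
    · obtain ⟨e, rfl⟩ := hr
      rw [matchPerm_right, apply_ite x, key, Finset.sum_eq_single e]
      · simp [left_ne_right hlr e e, add_comm]
      · intro e' _ he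
        simp [(right_injective hlr).ne he, left_ne_right hlr e' e]
      · simp
    · push Not at hl hr
      rw [matchPerm_of_notMem hlr P hl hr]
      simp [hl, hr]

/-- An exchange adds x(l) + x(r) at both ends of the pair, so it affects the sum over `A` only if
exactly one end lies in `A`. -/
lemma sum_apply_matchPerm {l r : E → I} (hlr : Function.Injective (Sum.elim l r))
    (x : I → ZMod 2) (P : E → ZMod 2) (A : I → Prop) [DecidablePred A] :
    (∑ i, if A i then x (matchPerm l r hlr P i) else 0) = (∑ i, if A i then x i else 0) +
      ∑ e, P e * (x (l e) + x (r e)) *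
        ((if A (l e) then 1 else 0) + if A (r e) then 1 else 0) := by
  have h : ∀ i, (if A i then x (matchPerm l r hlr P i) else 0) = (if A i then x i else 0) +
      ∑ e, P e * (x (l e) + x (r e)) *
        ((if l e = i then (if A i then 1 else 0) else 0) +
          if r e = i then (if A i then 1 else 0) else 0) := by
    intro i
    rw [apply_matchPerm hlr x P i]
    by_cases hA : A i <;> simp [hA]
  rw [Finset.sum_congr rfl fun i _ => h i, Finset.sum_add_distrib, Finset.sum_comm]
  congr 1
  refine Finset.sum_congr rfl fun e _ => ?_
  rw [← Finset.mul_sum, Finset.sum_add_distrib]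
  simp

/-! ### Vectors that split no pair of a matching -/

lemma prod_eq_prod_matching {l r : E → I} (hlr : Function.Injective (Sum.elim l r))
    (F : Finset E) (g : I → ℝ) :
    ∏ i, g i = (∏ e ∈ F, g (l e) * g (r e)) * ∏ i ∈ (F.image l ∪ F.image r)ᶜ, g i := by
  rw [← Finset.prod_mul_prod_compl (F.image l ∪ F.image r), Finset.prod_union,
    Finset.prod_image fun e _ e' _ h => left_injective hlr h,
    Finset.prod_image fun e _ e' _ h => right_injective hlr h, Finset.prod_mul_distrib]
  rw [Finset.disjoint_left]
  intro i hi hi'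
  obtain ⟨e, -, rfl⟩ := mem_image.1 hi
  obtain ⟨e', -, h⟩ := mem_image.1 hi'
  exact left_ne_right hlr e e' h.symm

lemma sum_zmod_two (f : ZMod 2 → ℝ) : ∑ b, f b = f 0 + f 1 := Fin.sum_univ_two f

/-- Coordinate weights for which a vector splitting no pair `(l e, r e)` has the same total weight
after its entries in `R` (the set of all `r e`) have been erased. -/
noncomputable def pairWeight (L R : Finset I) (i : I) (b : ZMod 2) : ℝ :=
  if b = 0 then 1 else if i ∈ R then 0 else if i ∈ L then 1 / 49 else 1 / 7

lemma left_notMem_image_right {l r : E → I} (hlr : Function.Injective (Sum.elim l r))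
    (F : Finset E) (e : E) : l e ∉ F.image r := fun h => by
  obtain ⟨e', -, h⟩ := mem_image.1 h
  exact left_ne_right hlr e e' h.symm

lemma pow_hammingNorm_eq_prod {l r : E → I} (hlr : Function.Injective (Sum.elim l r))
    (F : Finset E) (x : I → ZMod 2) (hx : ∀ e ∈ F, x (l e) = x (r e)) :
    (1 / 7 : ℝ) ^ hammingNorm x =
      ∏ i, pairWeight (F.image l) (F.image r) i (if i ∈ F.image r then 0 else x i) := by
  have h1 : (1 / 7 : ℝ) ^ hammingNorm x = ∏ i, if x i = 0 then 1 else (1 / 7 : ℝ) := by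
    rw [Finset.prod_ite, Finset.prod_const_one, one_mul, Finset.prod_const]
    rfl
  rw [h1, prod_eq_prod_matching hlr F, prod_eq_prod_matching hlr F
    (fun i => pairWeight (F.image l) (F.image r) i (if i ∈ F.image r then 0 else x i))]
  refine congrArg₂ _ (Finset.prod_congr rfl fun e he => ?_) (Finset.prod_congr rfl fun i hi => ?_)
  · have h2 := mem_image_of_mem r he
    have h3 := mem_image_of_mem l he
    rw [if_pos h2, if_neg (left_notMem_image_right hlr F e), hx e he, pairWeight, pairWeight,
      if_pos rfl, if_neg (left_notMem_image_right hlr F e), if_pos h3]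
    split_ifs <;> norm_num
  · rw [mem_compl, mem_union, not_or] at hi
    rw [if_neg hi.2, pairWeight, if_neg hi.2, if_neg hi.1]

lemma prod_sum_pairWeight {l r : E → I} (hlr : Function.Injective (Sum.elim l r))
    (F : Finset E) : ∏ i, ∑ b : ZMod 2, pairWeight (F.image l) (F.image r) i b =
      (8 / 7) ^ Fintype.card I * (25 / 32) ^ #F := by
  have hsum : ∀ i, ∑ b : ZMod 2, pairWeight (F.image l) (F.image r) i b =
      1 + if i ∈ F.image r then 0 else if i ∈ F.image l then 1 / 49 else (1 / 7 : ℝ) := by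
    intro i
    rw [sum_zmod_two, pairWeight, pairWeight, if_pos rfl, if_neg one_ne_zero]
  have h5 := prod_eq_prod_matching hlr F (fun _ => (8 / 7 : ℝ))
  rw [Finset.prod_const, Finset.card_univ] at h5
  have h6 : (8 / 7 : ℝ) ^ Fintype.card I * (25 / 32) ^ #F =
      (∏ e ∈ F, (8 / 7 * (8 / 7)) * (25 / 32)) * ∏ i ∈ (F.image l ∪ F.image r)ᶜ, (8 / 7 : ℝ) := by
    rw [h5]
    simp only [Finset.prod_const, mul_pow]
    ring
  rw [h6, prod_eq_prod_matching hlr F]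
  refine congrArg₂ _ (Finset.prod_congr rfl fun e he => ?_) (Finset.prod_congr rfl fun i hi => ?_)
  · have h2 := mem_image_of_mem r he
    have h3 := mem_image_of_mem l he
    rw [hsum, hsum, if_pos h2, if_neg (left_notMem_image_right hlr F e), if_pos h3]
    norm_num
  · rw [mem_compl, mem_union, not_or] at hi
    rw [hsum, if_neg hi.2, if_neg hi.1]
    norm_num

/-- A pair with equal entries contributes 1 + 1/49 = 50/49 to the generating function instead of
(8/7)² = 64/49, whence the ratio 25/32. Erasing the right ends is injective on these vectors and
makes the sum factor over the coordinates. -/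
lemma sum_nonsplit_le {l r : E → I} (hlr : Function.Injective (Sum.elim l r)) (F : Finset E) :
    ∑ x : I → ZMod 2 with ∀ e ∈ F, x (l e) = x (r e), (1 / 7 : ℝ) ^ hammingNorm x ≤
      (8 / 7) ^ Fintype.card I * (25 / 32) ^ #F := by
  let φ : (I → ZMod 2) → I → ZMod 2 := fun x i => if i ∈ F.image r then 0 else x i
  have hinj : Set.InjOn φ ↑({x : I → ZMod 2 | ∀ e ∈ F, x (l e) = x (r e)} : Finset _) := by
    intro x hx y hy hxy
    rw [mem_coe, mem_filter] at hx hy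
    have hoff : ∀ i, i ∉ F.image r → x i = y i := fun i hi => by
      have := congrFun hxy i
      simp only [φ] at this
      rwa [if_neg hi, if_neg hi] at this
    ext i
    by_cases hi : i ∈ F.image r
    · obtain ⟨e, he, rfl⟩ := mem_image.1 hi
      rw [← hx.2 e he, ← hy.2 e he, hoff _ (left_notMem_image_right hlr F e)]
    · rw [hoff i hi]
  rw [← prod_sum_pairWeight hlr F, Finset.prod_univ_sum, Fintype.piFinset_univ]
  rw [Finset.sum_congr rfl fun x hx => pow_hammingNorm_eq_prod hlr F x (mem_filter.1 hx).2]
  rw [← Finset.sum_image (g := φ)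
    (f := fun y => ∏ i, pairWeight (F.image l) (F.image r) i (y i)) hinj]
  refine Finset.sum_le_sum_of_subset_of_nonneg (Finset.subset_univ _) fun y _ _ =>
    Finset.prod_nonneg fun i _ => ?_
  rw [pairWeight]
  split_ifs <;> norm_num

/-- Chernoff's bound. The parameter 1/7 is the optimal one when the weight is an eighth of the
length, that is, n/4 out of 2n. -/
lemma card_nonsplit_le {l r : E → I} (hlr : Function.Injective (Sum.elim l r))
    (F : Finset E) (w : ℝ) :
    (#{x ∈ ball I w | ∀ e ∈ F, x (l e) = x (r e)} : ℝ) ≤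
      7 ^ w * ((8 / 7) ^ Fintype.card I * (25 / 32) ^ #F) := by
  have h7 : (0 : ℝ) < 7 := by norm_num
  calc (#{x ∈ ball I w | ∀ e ∈ F, x (l e) = x (r e)} : ℝ)
      = ∑ x ∈ ball I w with ∀ e ∈ F, x (l e) = x (r e), (1 : ℝ) := by simp
    _ ≤ ∑ x ∈ ball I w with ∀ e ∈ F, x (l e) = x (r e),
          (7 : ℝ) ^ w * (1 / 7) ^ hammingNorm x := by
        refine Finset.sum_le_sum fun x hx => ?_
        have hx := (mem_ball.1 (mem_filter.1 hx).1).2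
        rw [one_div, inv_pow, ← Real.rpow_natCast, ← Real.rpow_neg h7.le, ← Real.rpow_add h7]
        exact Real.one_le_rpow (by norm_num) (by linarith)
    _ ≤ ∑ x : I → ZMod 2 with ∀ e ∈ F, x (l e) = x (r e),
          (7 : ℝ) ^ w * (1 / 7) ^ hammingNorm x := by
        refine Finset.sum_le_sum_of_subset_of_nonneg
          (Finset.filter_subset_filter _ (Finset.subset_univ _)) fun x _ _ => by positivity
    _ ≤ _ := by
        rw [← Finset.mul_sum]
        exact mul_le_mul_of_nonneg_left (sum_nonsplit_le hlr F) (by positivity)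

end Matching

/-! ### Vectors with balanced class parities -/

/-- Here z is a flow along a path with s + 1 vertices. Summing over the vertices counts each edge
twice, so (s + 1)c = 0, and c = 0 because s + 1 is odd. The edges then vanish one after another from
the left end. -/
lemma flow_eq_zero {s : ℕ} (hs : Even s) (z : Fin s → ZMod 2) (c : ZMod 2)
    (h : ∀ u : Fin (s + 1), ∑ v, z v *
      ((if v.castSucc = u then 1 else 0) + if v.succ = u then 1 else 0) = c) : z = 0 := by
  have hc : c = 0 := by
    have h1 : ∑ u : Fin (s + 1), ∑ v, z v *
        ((if v.castSucc = u then 1 else 0) + if v.succ = u then 1 else 0) = 0 := by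
      rw [Finset.sum_comm]
      refine Finset.sum_eq_zero fun v _ => ?_
      rw [← Finset.mul_sum, Finset.sum_add_distrib]
      simp [CharTwo.add_self_eq_zero]
    rw [Finset.sum_congr rfl fun u _ => h u] at h1
    have h2 : ((s : ℕ) : ZMod 2) = 0 := (ZMod.natCast_eq_zero_iff_even).2 hs
    simpa [h2] using h1
  have key : ∀ (j : ℕ) (hj : j < s), z ⟨j, hj⟩ = 0 := by
    intro j
    induction j using Nat.strong_induction_on with
    | _ j ih =>
      intro hj
      have h1 := h (Fin.castSucc ⟨j, hj⟩)
      rw [hc, Finset.sum_eq_single (⟨j, hj⟩ : Fin s)] at h1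
      · have : ¬ (Fin.succ (⟨j, hj⟩ : Fin s) = Fin.castSucc ⟨j, hj⟩) := by
          simp [Fin.ext_iff]
        simpa [this] using h1
      · intro v _ hv
        by_cases hv' : v.val < j
        · rw [show v = ⟨v.val, v.2⟩ from rfl, ih v.val hv' v.2, zero_mul]
        · have h2 : ¬ (v.castSucc = Fin.castSucc ⟨j, hj⟩) := by simpa [Fin.ext_iff] using hv
          have h3 : ¬ (v.succ = Fin.castSucc ⟨j, hj⟩) := by
            simp only [Fin.ext_iff, Fin.val_succ, Fin.val_castSucc]
            omega
          rw [if_neg h2, if_neg h3, add_zero, mul_zero]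
      · simp
  funext v
  exact key v.val v.2

section Balanced

variable {I κ : Type*} [Fintype I] [DecidableEq I] [Fintype κ] [DecidableEq κ] {s h : ℕ}

/-- For every `k`, the sum of `x` over the class `(k, u)` does not depend on `u`. -/
def Balanced (cl : I → κ × Fin (s + 1)) (x : I → ZMod 2) : Prop :=
  ∀ k, ∃ c : ZMod 2, ∀ u, (∑ i, if cl i = (k, u) then x i else 0) = c

/-- The bundles `b` containing a pair on which `x` is not constant. -/
def splitBundles (l r : (κ × Fin s) × Fin h → I) (x : I → ZMod 2) : Finset (κ × Fin s) :=
  {b | ∃ t, x (l (b, t)) ≠ x (r (b, t))}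

variable {cl : I → κ × Fin (s + 1)} {l r : (κ × Fin s) × Fin h → I}

lemma flow_eq_of_balanced (hs : Even s) (hlr : Function.Injective (Sum.elim l r))
    (hl : ∀ k u t, cl (l ((k, u), t)) = (k, u.castSucc))
    (hr : ∀ k u t, cl (r ((k, u), t)) = (k, u.succ)) {x : I → ZMod 2}
    {P Q : (κ × Fin s) × Fin h → ZMod 2} (hP : Balanced cl (x ∘ matchPerm l r hlr P))
    (hQ : Balanced cl (x ∘ matchPerm l r hlr Q)) (b : κ × Fin s) :
    ∑ t, (P (b, t) - Q (b, t)) * (x (l (b, t)) + x (r (b, t))) = 0 := by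
  obtain ⟨k, u⟩ := b
  obtain ⟨c, hc⟩ := hP k
  obtain ⟨d, hd⟩ := hQ k
  refine congrFun (flow_eq_zero hs (fun u => ∑ t, (P ((k, u), t) - Q ((k, u), t)) *
    (x (l ((k, u), t)) + x (r ((k, u), t)))) (c - d) fun u => ?_) u
  have h1 : ∀ P : (κ × Fin s) × Fin h → ZMod 2,
      (∑ i, if cl i = (k, u) then (x ∘ matchPerm l r hlr P) i else 0) =
      (∑ i, if cl i = (k, u) then x i else 0) + ∑ v : Fin s, (∑ t, P ((k, v), t) *
        (x (l ((k, v), t)) + x (r ((k, v), t)))) *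
        ((if v.castSucc = u then 1 else 0) + if v.succ = u then 1 else 0) := by
    intro P
    refine (sum_apply_matchPerm hlr x P fun i => cl i = (k, u)).trans ?_
    congr 1
    rw [Fintype.sum_prod_type, Fintype.sum_prod_type, Finset.sum_eq_single k]
    · refine Finset.sum_congr rfl fun v _ => ?_
      rw [Finset.sum_mul]
      refine Finset.sum_congr rfl fun t _ => ?_
      simp [hl, hr]
    · intro k' _ hk
      refine Finset.sum_eq_zero fun v _ => Finset.sum_eq_zero fun t _ => ?_
      simp [hl, hr, hk]
    · simp
  rw [← hc u, ← hd u, h1 P, h1 Q, add_sub_add_left_eq_sub, ← Finset.sum_sub_distrib]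
  refine Finset.sum_congr rfl fun v _ => ?_
  rw [← sub_mul, ← Finset.sum_sub_distrib]
  simp only [sub_mul]

open Classical in
-- Choose one pair with unequal entries in each split bundle. If two balancing swaps agree off the
-- chosen pairs, the flow through each bundle forces them to agree on the chosen pair too, where the
-- coefficient x(l) + x(r) is 1. So each split bundle costs one free bit.
lemma card_balanced_swaps_le (hs : Even s) (hlr : Function.Injective (Sum.elim l r))
    (hl : ∀ k u t, cl (l ((k, u), t)) = (k, u.castSucc))
    (hr : ∀ k u t, cl (r ((k, u), t)) = (k, u.succ)) (x : I → ZMod 2) :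
    (#{P : (κ × Fin s) × Fin h → ZMod 2 | Balanced cl (x ∘ matchPerm l r hlr P)}) *
      2 ^ #(splitBundles l r x) ≤ 2 ^ Fintype.card ((κ × Fin s) × Fin h) := by
  have hex : ∀ b : splitBundles l r x, ∃ t, x (l (b.1, t)) ≠ x (r (b.1, t)) := fun b =>
    (mem_filter.1 b.2).2
  choose f hf using hex
  let S : Finset ((κ × Fin s) × Fin h) :=
    (univ : Finset (splitBundles l r x)).image fun b => (b.1, f b)
  have hS : #S = #(splitBundles l r x) := by
    rw [Finset.card_image_of_injective _ fun b b' hb => Subtype.ext (congrArg Prod.fst hb)]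
    simp
  have hcard : Fintype.card ((({e // e ∉ S} : Type _) → ZMod 2) × (S → ZMod 2)) =
      2 ^ Fintype.card ((κ × Fin s) × Fin h) := by
    rw [Fintype.card_prod, Fintype.card_fun, Fintype.card_fun, ← pow_add, ZMod.card]
    congr 1
    rw [Fintype.card_subtype_compl, Fintype.card_coe]
    exact Nat.sub_add_cancel (Finset.card_le_univ _)
  rw [← hcard, Fintype.card_prod, Fintype.card_fun, ZMod.card, Fintype.card_fun, ZMod.card,
    Fintype.card_coe, hS]
  refine Nat.mul_le_mul_right _ ?_
  have hfun : 2 ^ Fintype.card {e // e ∉ S} = #(univ : Finset ({e // e ∉ S} → ZMod 2)) := by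
    rw [Finset.card_univ, Fintype.card_fun, ZMod.card]
  rw [hfun]
  refine Finset.card_le_card_of_injOn (fun P e => P e.1) (fun _ _ => mem_univ _) ?_
  intro P hP Q hQ hPQ
  have hP := (mem_filter.1 (mem_coe.1 hP)).2
  have hQ := (mem_filter.1 (mem_coe.1 hQ)).2
  have hoff : ∀ e, e ∉ S → P e = Q e := fun e he => congrFun hPQ ⟨e, he⟩
  ext e
  by_cases he : e ∈ S
  · obtain ⟨b, -, rfl⟩ := mem_image.1 he
    have h0 := flow_eq_of_balanced hs hlr hl hr hP hQ b.1
    rw [Finset.sum_eq_single (f b)] at h0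
    · have h1 : ∀ a b : ZMod 2, a ≠ b → a + b = 1 := by decide
      rw [h1 _ _ (hf b), mul_one, sub_eq_zero] at h0
      rw [h0]
    · intro t _ ht
      have : (b.1, t) ∉ S := by
        intro hmem
        obtain ⟨b', -, hb'⟩ := mem_image.1 hmem
        have h2 : b' = b := Subtype.ext (congrArg Prod.fst hb')
        subst h2
        exact ht (congrArg Prod.snd hb').symm
      rw [hoff _ this, sub_self, zero_mul]
    · simp
  · rw [hoff e he]

open Classical in
-- Average over all swaps: each permutes the ball, so the count is the sum over x of the probability
-- that a random swap balances x.
lemma card_balanced_le_sum (hs : Even s) (hlr : Function.Injective (Sum.elim l r))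
    (hl : ∀ k u t, cl (l ((k, u), t)) = (k, u.castSucc))
    (hr : ∀ k u t, cl (r ((k, u), t)) = (k, u.succ)) (w : ℝ) :
    (#{x ∈ ball I w | Balanced cl x} : ℝ) ≤
      ∑ x ∈ ball I w, (1 / 2 : ℝ) ^ #(splitBundles l r x) := by
  have hperm : ∀ P : (κ × Fin s) × Fin h → ZMod 2, #{x ∈ ball I w | Balanced cl x} =
      #{x ∈ ball I w | Balanced cl (x ∘ matchPerm l r hlr P)} := by
    intro P
    refine (Finset.card_bij (fun x _ => x ∘ matchPerm l r hlr P) ?_ ?_ ?_).symm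
    · intro x hx
      rw [mem_filter] at hx ⊢
      exact ⟨(comp_perm_mem_ball _).2 hx.1, hx.2⟩
    · intro x _ y _ hxy
      exact (matchPerm l r hlr P).surjective.injective_comp_right hxy
    · intro y hy
      rw [mem_filter] at hy
      have : (y ∘ (matchPerm l r hlr P).symm) ∘ matchPerm l r hlr P = y := by
        ext i
        simp
      refine ⟨y ∘ (matchPerm l r hlr P).symm, ?_, this⟩
      rw [mem_filter, this]
      exact ⟨(comp_perm_mem_ball _).2 hy.1, hy.2⟩
  have hdouble : 2 ^ Fintype.card ((κ × Fin s) × Fin h) * #{x ∈ ball I w | Balanced cl x} =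
      ∑ x ∈ ball I w, #{P : (κ × Fin s) × Fin h → ZMod 2 |
        Balanced cl (x ∘ matchPerm l r hlr P)} := by
    have h1 := Finset.sum_card_bipartiteAbove_eq_sum_card_bipartiteBelow
      (s := ball I w) (t := (univ : Finset ((κ × Fin s) × Fin h → ZMod 2)))
      (fun x P => Balanced cl (x ∘ matchPerm l r hlr P))
    simp only [bipartiteAbove, bipartiteBelow] at h1
    rw [h1, ← Finset.sum_congr rfl fun P _ => hperm P, Finset.sum_const, Finset.card_univ,
      Fintype.card_fun, ZMod.card, smul_eq_mul]
  have hpos : (0 : ℝ) < 2 ^ Fintype.card ((κ × Fin s) × Fin h) := by positivity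
  refine le_of_mul_le_mul_left ?_ hpos
  have hd : (2 : ℝ) ^ Fintype.card ((κ × Fin s) × Fin h) * #{x ∈ ball I w | Balanced cl x} =
      ∑ x ∈ ball I w, (#{P : (κ × Fin s) × Fin h → ZMod 2 |
        Balanced cl (x ∘ matchPerm l r hlr P)} : ℝ) := by exact_mod_cast hdouble
  rw [hd, Finset.mul_sum]
  refine Finset.sum_le_sum fun x _ => ?_
  have h2 : (#{P : (κ × Fin s) × Fin h → ZMod 2 | Balanced cl (x ∘ matchPerm l r hlr P)} : ℝ) *
      2 ^ #(splitBundles l r x) ≤ 2 ^ Fintype.card ((κ × Fin s) × Fin h) := by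
    exact_mod_cast card_balanced_swaps_le hs hlr hl hr x
  rw [one_div, inv_pow, ← div_eq_mul_inv]
  exact (le_div_iff₀ (by positivity)).2 h2

open Classical in
/-- Few vectors of the ball have balanced class parities. -/
lemma card_balanced_le (hs : Even s) (hlr : Function.Injective (Sum.elim l r))
    (hl : ∀ k u t, cl (l ((k, u), t)) = (k, u.castSucc))
    (hr : ∀ k u t, cl (r ((k, u), t)) = (k, u.succ)) (w : ℝ) (g : ℕ) :
    (#{x ∈ ball I w | Balanced cl x} : ℝ) ≤
      #(ball I w) * (1 / 2) ^ (Fintype.card (κ × Fin s) - g) +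
        2 ^ Fintype.card (κ × Fin s) *
          (7 ^ w * ((8 / 7) ^ Fintype.card I * (25 / 32) ^ (g * h))) := by
  refine (card_balanced_le_sum hs hlr hl hr w).trans ?_
  -- Vectors that split all but at most `g` bundles have small probability of being balanced; the
  -- others are few, and for them the probability is bounded by 1.
  rw [← Finset.sum_filter_add_sum_filter_not (ball I w)
    fun x => Fintype.card (κ × Fin s) - g ≤ #(splitBundles l r x)]
  refine add_le_add ?_ ?_
  · rw [← nsmul_eq_mul]
    refine (Finset.sum_le_card_nsmul _ _ ((1 / 2 : ℝ) ^ (Fintype.card (κ × Fin s) - g))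
      fun x hx => ?_).trans ?_
    · exact pow_le_pow_of_le_one (by norm_num) (by norm_num) (mem_filter.1 hx).2
    · exact nsmul_le_nsmul_left (by positivity) (Finset.card_filter_le _ _)
  · have h1 : ∑ x ∈ ball I w with ¬ (Fintype.card (κ × Fin s) - g ≤ #(splitBundles l r x)),
        (1 / 2 : ℝ) ^ #(splitBundles l r x) ≤
        #{x ∈ ball I w | ¬ (Fintype.card (κ × Fin s) - g ≤ #(splitBundles l r x))} := by
      rw [← nsmul_one]
      exact Finset.sum_le_card_nsmul _ _ _ fun x _ =>
        pow_le_one₀ (by norm_num) (by norm_num)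
    refine h1.trans ?_
    -- A vector with few split bundles has `g` bundles on whose pairs it is constant; take the union
    -- over the choice `J` of such bundles.
    have h2 : ({x ∈ ball I w | ¬ (Fintype.card (κ × Fin s) - g ≤ #(splitBundles l r x))} :
        Finset _) ⊆ (powersetCard g (univ : Finset (κ × Fin s))).biUnion fun J =>
          {x ∈ ball I w | ∀ e ∈ J ×ˢ (univ : Finset (Fin h)), x (l e) = x (r e)} := by
      intro x hx
      rw [mem_filter] at hx
      have hle : g ≤ #(splitBundles l r x)ᶜ := by
        rw [card_compl]
        omega
      obtain ⟨J, hJ, hJg⟩ := Finset.exists_subset_card_eq hle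
      rw [mem_biUnion]
      refine ⟨J, mem_powersetCard.2 ⟨subset_univ _, hJg⟩, mem_filter.2 ⟨hx.1, ?_⟩⟩
      rintro ⟨b, t⟩ he
      have := mem_compl.1 (hJ (mem_product.1 he).1)
      simp only [splitBundles, mem_filter, mem_univ, true_and, not_exists, not_not] at this
      exact this t
    have h3 := (Finset.card_le_card h2).trans Finset.card_biUnion_le
    have h4 : (#{x ∈ ball I w | ¬ (Fintype.card (κ × Fin s) - g ≤ #(splitBundles l r x))} : ℝ) ≤
        ∑ J ∈ powersetCard g (univ : Finset (κ × Fin s)),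
          (#{x ∈ ball I w | ∀ e ∈ J ×ˢ (univ : Finset (Fin h)), x (l e) = x (r e)} : ℝ) := by
      exact_mod_cast h3
    refine h4.trans ((Finset.sum_le_card_nsmul _ _
      (7 ^ w * ((8 / 7) ^ Fintype.card I * (25 / 32) ^ (g * h))) fun J hJ => ?_).trans ?_)
    · refine (card_nonsplit_le hlr _ w).trans_eq ?_
      rw [card_product, (mem_powersetCard.1 hJ).2, card_univ, Fintype.card_fin]
    · rw [nsmul_eq_mul]
      refine mul_le_mul_of_nonneg_right ?_ (by positivity)
      have : #(powersetCard g (univ : Finset (κ × Fin s))) ≤ 2 ^ Fintype.card (κ × Fin s) := by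
        rw [← Finset.card_univ, ← card_powerset]
        exact Finset.card_le_card (fun J hJ => mem_powerset.2 (subset_univ _))
      exact_mod_cast this

end Balanced

/-! ### Vectors whose folds have a smaller period -/

/-- The two halves of `v`, reduced modulo `q`, have period `q'`. -/
def FoldPeriodic {n : ℕ} [NeZero n] (q' q : ℕ) (v : ZMod n ⊕ ZMod n → ZMod 2) : Prop :=
  (∀ c : ZMod q, fold q (v ∘ Sum.inl) (c - q') = fold q (v ∘ Sum.inl) c) ∧
    ∀ c : ZMod q, fold q (v ∘ Sum.inr) (c - q') = fold q (v ∘ Sum.inr) c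

section Grid

/-- The position with coordinates `c < q'`, `u < p` and `t` in a grid. -/
def gridPos (q' p c u t : ℕ) : ℕ := c + q' * (u + p * t)

lemma gridPos_mod {q' p c u t : ℕ} (hc : c < q') : gridPos q' p c u t % q' = c := by
  rw [gridPos, Nat.add_mul_mod_self_left, Nat.mod_eq_of_lt hc]

lemma gridPos_div {q' p c u t : ℕ} (hc : c < q') : gridPos q' p c u t / q' = u + p * t := by
  rw [gridPos, Nat.add_mul_div_left _ _ (by omega), Nat.div_eq_of_lt hc, zero_add]

lemma gridPos_lt {q' p c u t ρ : ℕ} (hc : c < q') (hu : u < p) (ht : t < ρ) :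
    gridPos q' p c u t < q' * p * ρ := by
  have h1 : u + p * t + 1 ≤ p * ρ := by
    have : p * (t + 1) ≤ p * ρ := Nat.mul_le_mul_left _ ht
    rw [Nat.mul_add] at this
    omega
  have h2 := Nat.mul_le_mul_left q' h1
  rw [gridPos, mul_assoc]
  rw [Nat.mul_add] at h2
  omega

lemma gridPos_inj {q' p c u t c' u' t' : ℕ} (hc : c < q') (hu : u < p) (hc' : c' < q')
    (hu' : u' < p) (h : gridPos q' p c u t = gridPos q' p c' u' t') :
    c = c' ∧ u = u' ∧ t = t' := by
  have h1 := congrArg (· % q') h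
  have h2 := congrArg (· / q') h
  simp only [gridPos_mod hc, gridPos_mod hc', gridPos_div hc, gridPos_div hc'] at h1 h2
  have h3 := congrArg (· % p) h2
  have h4 := congrArg (· / p) h2
  simp only [Nat.add_mul_mod_self_left, Nat.mod_eq_of_lt hu, Nat.mod_eq_of_lt hu'] at h3
  simp only [Nat.add_mul_div_left _ _ (Nat.zero_lt_of_lt hu), Nat.div_eq_of_lt hu,
    Nat.div_eq_of_lt hu', zero_add] at h4
  exact ⟨h1, h3, h4⟩

variable {q' s n : ℕ} [NeZero q'] [NeZero n]

/-- The class of a coordinate: its half, its residue modulo `q'`, and the next digit. -/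
def gridClass (q' s : ℕ) [NeZero q'] (i : ZMod n ⊕ ZMod n) : (Bool × Fin q') × Fin (s + 1) :=
  let j := (Equiv.boolProdEquivSum (ZMod n)).symm i
  ((j.1, ⟨j.2.val % q', Nat.mod_lt _ (NeZero.pos q')⟩),
    ⟨j.2.val / q' % (s + 1), Nat.mod_lt _ s.succ_pos⟩)

/-- The position with given class `(k, u)` and last digit `t`. -/
def gridCoord (q' s n : ℕ) (k : Bool × Fin q') (u t : ℕ) : ZMod n ⊕ ZMod n :=
  Equiv.boolProdEquivSum (ZMod n) (k.1, (gridPos q' (s + 1) k.2 u t : ℕ))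

lemma gridClass_gridCoord {ρ : ℕ} (hn : n = q' * (s + 1) * ρ) (k : Bool × Fin q') {u t : ℕ}
    (hu : u < s + 1) (ht : t < ρ) :
    gridClass q' s (gridCoord q' s n k u t) = (k, ⟨u, hu⟩) := by
  have hlt : gridPos q' (s + 1) k.2 u t < n := hn ▸ gridPos_lt k.2.2 hu ht
  simp only [gridClass, gridCoord, Equiv.symm_apply_apply, ZMod.val_natCast,
    Nat.mod_eq_of_lt hlt, gridPos_mod k.2.2, gridPos_div k.2.2, Nat.add_mul_mod_self_left,
    Nat.mod_eq_of_lt hu]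

lemma gridCoord_inj {ρ : ℕ} (hn : n = q' * (s + 1) * ρ) {k k' : Bool × Fin q'} {u t u' t' : ℕ}
    (hu : u < s + 1) (ht : t < ρ) (hu' : u' < s + 1) (ht' : t' < ρ)
    (h : gridCoord q' s n k u t = gridCoord q' s n k' u' t') : k = k' ∧ u = u' ∧ t = t' := by
  have h1 := (Equiv.boolProdEquivSum (ZMod n)).injective h
  have h2 := congrArg (fun j => ZMod.val j.2) h1
  simp only [ZMod.val_natCast] at h2
  rw [Nat.mod_eq_of_lt (hn ▸ gridPos_lt k.2.2 hu ht),
    Nat.mod_eq_of_lt (hn ▸ gridPos_lt k'.2.2 hu' ht')] at h2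
  obtain ⟨h3, h4, h5⟩ := gridPos_inj k.2.2 hu k'.2.2 hu' h2
  exact ⟨Prod.ext (Prod.mk.inj h1).1 (Fin.ext h3), h4, h5⟩

lemma sum_gridClass (v : ZMod n ⊕ ZMod n → ZMod 2) (b : Bool) (c : Fin q') (u : Fin (s + 1)) :
    (∑ i, if gridClass q' s i = ((b, c), u) then v i else 0) =
      fold (q' * (s + 1)) (fun i => v (Equiv.boolProdEquivSum (ZMod n) (b, i)))
        ((c : ℕ) + (u : ℕ) * (q' : ℕ)) := by
  rw [← (Equiv.boolProdEquivSum (ZMod n)).sum_comp, Fintype.sum_prod_type,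
    Finset.sum_eq_single b]
  · refine Finset.sum_congr rfl fun i _ => ?_
    have hlt : (c : ℕ) + q' * u < q' * (s + 1) := by
      have := gridPos_lt (t := 0) (ρ := 1) c.2 u.2 one_pos
      simpa [gridPos] using this
    have hiff : gridClass q' s (Equiv.boolProdEquivSum (ZMod n) (b, i)) = ((b, c), u) ↔
        (i.val : ZMod (q' * (s + 1))) = (c : ℕ) + (u : ℕ) * (q' : ℕ) := by
      have h1 : ((c : ℕ) : ZMod (q' * (s + 1))) + (u : ℕ) * (q' : ℕ) =
          ((c + q' * u : ℕ) : ZMod (q' * (s + 1))) := by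
        push_cast
        ring
      rw [h1, ZMod.natCast_eq_natCast_iff', Nat.mod_eq_of_lt hlt, Nat.mod_mul]
      simp only [gridClass, Equiv.symm_apply_apply, Prod.mk.injEq, true_and, Fin.ext_iff]
      constructor
      · rintro ⟨h2, h3⟩
        rw [h2, h3]
      · intro h2
        have hm := Nat.mod_lt i.val (NeZero.pos q')
        have h3 := congrArg (· % q') h2
        have h4 := congrArg (· / q') h2
        simp only [Nat.add_mul_mod_self_left, Nat.mod_eq_of_lt hm, Nat.mod_eq_of_lt c.2] at h3
        simp only [Nat.add_mul_div_left _ _ (NeZero.pos q'), Nat.div_eq_of_lt hm,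
          Nat.div_eq_of_lt c.2, zero_add] at h4
        exact ⟨h3, h4⟩
    rw [if_congr hiff rfl rfl]
  · intro b' _ hb
    refine Finset.sum_eq_zero fun i _ => if_neg ?_
    simp only [gridClass, Equiv.symm_apply_apply, Prod.mk.injEq, hb, false_and, not_false_eq_true]
  · simp

lemma balanced_of_foldPeriodic {v : ZMod n ⊕ ZMod n → ZMod 2}
    (hv : FoldPeriodic q' (q' * (s + 1)) v) : Balanced (gridClass q' s) v := by
  rintro ⟨b, c⟩
  have hb : ∀ c : ZMod (q' * (s + 1)),
      fold (q' * (s + 1)) (fun i => v (Equiv.boolProdEquivSum (ZMod n) (b, i))) (c - q') =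
      fold (q' * (s + 1)) (fun i => v (Equiv.boolProdEquivSum (ZMod n) (b, i))) c := by
    cases b
    · exact hv.1
    · exact hv.2
  refine ⟨fold (q' * (s + 1)) (fun i => v (Equiv.boolProdEquivSum (ZMod n) (b, i))) (c : ℕ),
    fun u => ?_⟩
  rw [sum_gridClass]
  induction (u : ℕ) with
  | zero => simp
  | succ k ih =>
    rw [← ih, ← hb]
    congr 1
    push_cast
    ring

open Classical in
lemma card_foldPeriodic_le {q ρ h : ℕ} (hs : Even s) (hq : q = q' * (s + 1)) (hn : n = q * ρ)
    (hρ : 2 * h ≤ ρ) (w : ℝ) (g : ℕ) :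
    (#{v ∈ ball (ZMod n ⊕ ZMod n) w | FoldPeriodic q' q v} : ℝ) ≤
      #(ball (ZMod n ⊕ ZMod n) w) * (1 / 2) ^ (2 * q' * s - g) +
        2 ^ (2 * q' * s) * (7 ^ w * ((8 / 7) ^ (2 * n) * (25 / 32) ^ (g * h))) := by
  subst hq
  -- A middle class is the right end of one bundle and the left end of the next. Giving the last
  -- digit the parity of u keeps the two sets of positions disjoint, which is why ρ ≥ 2h is needed.
  let l : ((Bool × Fin q') × Fin s) × Fin h → ZMod n ⊕ ZMod n := fun e =>
    gridCoord q' s n e.1.1 e.1.2 (2 * e.2 + e.1.2 % 2)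
  let r : ((Bool × Fin q') × Fin s) × Fin h → ZMod n ⊕ ZMod n := fun e =>
    gridCoord q' s n e.1.1 (e.1.2 + 1) (2 * e.2 + e.1.2 % 2)
  have ht : ∀ e : ((Bool × Fin q') × Fin s) × Fin h, 2 * (e.2 : ℕ) + e.1.2 % 2 < ρ := fun e => by
    have := e.2.2
    omega
  have hlr : Function.Injective (Sum.elim l r) := by
    rintro (e | e) (e' | e') he
    all_goals
      obtain ⟨h1, h2, h3⟩ := gridCoord_inj hn (by omega) (ht e) (by omega) (ht e') he
    · have h4 : (e.2 : ℕ) = e'.2 := by omega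
      exact congrArg _ (Prod.ext (Prod.ext h1 (Fin.ext h2)) (Fin.ext h4))
    · omega
    · omega
    · have h4 : (e.2 : ℕ) = e'.2 := by omega
      exact congrArg _ (Prod.ext (Prod.ext h1 (Fin.ext (by omega))) (Fin.ext h4))
  have hmain := card_balanced_le (cl := gridClass (n := n) q' s) (l := l) (r := r) hs hlr
    (fun k u t => gridClass_gridCoord hn k (by omega) (ht ((k, u), t)))
    (fun k u t => gridClass_gridCoord hn k (by omega) (ht ((k, u), t))) w g
  have hc1 : Fintype.card ((Bool × Fin q') × Fin s) = 2 * q' * s := by simp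
  have hc2 : Fintype.card (ZMod n ⊕ ZMod n) = 2 * n := by
    simp [ZMod.card, two_mul]
  rw [hc1, hc2] at hmain
  refine le_trans ?_ hmain
  exact_mod_cast Finset.card_le_card
    (Finset.monotone_filter_right _ fun v _ hv => balanced_of_foldPeriodic hv)

end Grid

/-! ### Codes containing an aperiodic vector of small weight -/

/-- Simultaneous translation of both halves of the coordinates. -/
def translate {n : ℕ} (t : ZMod n) : Equiv.Perm (ZMod n ⊕ ZMod n) :=
  Equiv.sumCongr (Equiv.addRight t) (Equiv.addRight t)

section

variable {n : ℕ} [NeZero n]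

lemma InCode.translate {a : ZMod n → ZMod 2} {v : ZMod n ⊕ ZMod n → ZMod 2} (h : InCode a v)
    (t : ZMod n) : InCode a (v ∘ translate t) := by
  intro i
  rw [← h (i + t)]
  refine congrArg₂ _ rfl (Fintype.sum_equiv (Equiv.addRight t) _ _ fun j => ?_)
  simp [DoubleCirculant.translate]

lemma comp_translate_add (v : ZMod n ⊕ ZMod n → ZMod 2) (s t : ZMod n) :
    v ∘ translate (s + t) = (v ∘ translate t) ∘ translate s := by
  ext (i | i) <;> simp [translate, add_assoc]

lemma comp_translate_zero (v : ZMod n ⊕ ZMod n → ZMod 2) : v ∘ translate 0 = v := by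
  ext (i | i) <;> simp [translate]

lemma comp_translate_mul {v : ZMod n ⊕ ZMod n → ZMod 2} {d : ZMod n}
    (h : v ∘ translate d = v) (e : ZMod n) : v ∘ translate (e * d) = v := by
  have key : ∀ k : ℕ, v ∘ translate ((k : ZMod n) * d) = v := by
    intro k
    induction k with
    | zero => rw [Nat.cast_zero, zero_mul, comp_translate_zero]
    | succ k ih => rw [Nat.cast_succ, add_mul, one_mul, comp_translate_add, h, ih]
  simpa using key e.val

end

lemma exists_mul_eq_prime_pow {p m : ℕ} (hp : p.Prime) {d : ZMod (p ^ (m + 1))} (hd : d ≠ 0) :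
    ∃ e, e * d = ((p ^ m : ℕ) : ZMod (p ^ (m + 1))) := by
  have : NeZero (p ^ (m + 1)) := ⟨pow_ne_zero _ hp.ne_zero⟩
  obtain ⟨i, hi, hgcd⟩ := (Nat.dvd_prime_pow hp).1 (Nat.gcd_dvd_right d.val (p ^ (m + 1)))
  have him : i ≤ m := by
    by_contra! hlt
    have h1 : p ^ (m + 1) ∣ d.val :=
      ((pow_dvd_pow p hlt).trans hgcd.symm.dvd).trans (Nat.gcd_dvd_left _ _)
    exact hd ((ZMod.val_eq_zero d).1 (Nat.eq_zero_of_dvd_of_lt h1 d.val_lt))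
  have hb := congrArg (Int.cast : ℤ → ZMod (p ^ (m + 1))) (Nat.gcd_eq_gcd_ab d.val (p ^ (m + 1)))
  rw [hgcd] at hb
  have hz : ((p ^ (m + 1) : ℕ) : ZMod (p ^ (m + 1))) = 0 := ZMod.natCast_self _
  rw [Int.cast_add, Int.cast_mul, Int.cast_mul, Int.cast_natCast, Int.cast_natCast,
    Int.cast_natCast, hz, zero_mul, add_zero, ZMod.natCast_zmod_val] at hb
  refine ⟨((p ^ (m - i) : ℕ) : ZMod (p ^ (m + 1))) * (Nat.gcdA d.val (p ^ (m + 1))), ?_⟩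
  rw [mul_assoc, mul_comm _ d, ← hb, ← Nat.cast_mul, ← pow_add, Nat.sub_add_cancel him]

section

variable {p m : ℕ} [NeZero (p ^ (m + 1))]

/-- The binary vector `v` has the period `p ^ m`. -/
def HasSmallPeriod (v : ZMod (p ^ (m + 1)) ⊕ ZMod (p ^ (m + 1)) → ZMod 2) : Prop :=
  v ∘ translate ((p ^ m : ℕ) : ZMod (p ^ (m + 1))) = v

/-- Coinciding translates give a nonzero period d, and some multiple of d in `ZMod (p ^ (m + 1))` is
p^m. -/
lemma translate_injective (hp : p.Prime) {v : ZMod (p ^ (m + 1)) ⊕ ZMod (p ^ (m + 1)) → ZMod 2}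
    (hv : ¬ HasSmallPeriod v) : Function.Injective fun t => v ∘ translate t := by
  intro t t' h
  by_contra hne
  obtain ⟨e, he⟩ := exists_mul_eq_prime_pow hp (sub_ne_zero.2 hne)
  refine hv ?_
  rw [HasSmallPeriod, ← he]
  refine comp_translate_mul ?_ e
  have h1 : v ∘ translate t = v ∘ translate t' := h
  rw [sub_eq_neg_add, comp_translate_add, h1, ← comp_translate_add, neg_add_cancel,
    comp_translate_zero]

lemma foldPeriodic_of_dvd (hp : p.Prime) {M : ℕ} (hM : M < m + 1)
    {a : ZMod (p ^ (m + 1)) → ZMod 2} {v : ZMod (p ^ (m + 1)) ⊕ ZMod (p ^ (m + 1)) → ZMod 2}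
    (hv : InCode a v) (h : cyclotomic (p ^ (M + 1)) (ZMod 2) ∣ vecPoly (v ∘ Sum.inr)) :
    FoldPeriodic (p ^ M) (p ^ (M + 1)) v :=
  ⟨fold_sub_eq_of_cyclotomic_dvd hp (hv.cyclotomic_dvd hp hM h),
    fold_sub_eq_of_cyclotomic_dvd hp h⟩

lemma hasSmallPeriod_of_foldPeriodic {v : ZMod (p ^ (m + 1)) ⊕ ZMod (p ^ (m + 1)) → ZMod 2}
    (h : FoldPeriodic (p ^ m) (p ^ (m + 1)) v) : HasSmallPeriod v := by
  obtain ⟨h1, h2⟩ := h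
  rw [fold_self] at h1 h2
  ext (i | i)
  · simpa [translate] using (h1 (i + (p ^ m : ℕ))).symm
  · simpa [translate] using (h2 (i + (p ^ m : ℕ))).symm

open Classical in
-- Take the least M such that no Φ_{p^(i+1)} with i ≥ M divides the right half. If M = 0, at most 2
-- columns remain; otherwise minimality gives a factor dividing both halves and hence a periodic
-- fold. Passing to the left half needs one column that admits v, so the empty case is separate.
lemma card_inCode_le_sum (hp : IsKasamiPrime p)
    {v : ZMod (p ^ (m + 1)) ⊕ ZMod (p ^ (m + 1)) → ZMod 2} (hv : ¬ HasSmallPeriod v) :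
    #{a : ZMod (p ^ (m + 1)) → ZMod 2 | InCode a v} ≤
      2 + ∑ M ∈ range m, if FoldPeriodic (p ^ M) (p ^ (M + 1)) v then 2 ^ p ^ (M + 1) else 0 := by
  rcases Finset.eq_empty_or_nonempty ({a : ZMod (p ^ (m + 1)) → ZMod 2 | InCode a v} : Finset _)
    with hempty | ⟨a, ha⟩
  · simp [hempty]
  replace ha := (mem_filter.1 ha).2
  let good : ℕ → Prop := fun M => ∀ i, M ≤ i → i < m + 1 →
    ¬ cyclotomic (p ^ (i + 1)) (ZMod 2) ∣ vecPoly (v ∘ Sum.inr)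
  have htop : good m := by
    intro i hi hi' hdvd
    obtain rfl : i = m := by omega
    exact hv (hasSmallPeriod_of_foldPeriodic (foldPeriodic_of_dvd hp.1 hi' ha hdvd))
  have hex : ∃ M, good M := ⟨m, htop⟩
  have hMm : Nat.find hex ≤ m := Nat.find_min' hex htop
  have hcard := card_inCode_le hp (hMm.trans m.le_succ) v (Nat.find_spec hex)
  rw [Nat.card_eq_fintype_card, Fintype.card_subtype] at hcard
  refine hcard.trans ?_
  rcases hM : Nat.find hex with _ | M
  · simp
  · have hnot : ¬ good M := Nat.find_min hex (by omega)
    have hspec : good (M + 1) := hM ▸ Nat.find_spec hex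
    have hper : FoldPeriodic (p ^ M) (p ^ (M + 1)) v := by
      simp only [good, not_forall, not_not] at hnot
      obtain ⟨i, hi, hi', hdvd⟩ := hnot
      rcases hi.eq_or_lt with rfl | hlt
      · exact foldPeriodic_of_dvd hp.1 hi' ha hdvd
      · exact absurd hdvd (hspec i hlt hi')
    refine le_add_left ?_
    refine le_trans ?_ (Finset.single_le_sum (fun _ _ => Nat.zero_le _)
      (mem_range.2 (show M < m by omega)))
    rw [if_pos hper]

open Classical in
-- Double counting of pairs (a, v): every column on the left admits all p^(m+1) distinct translates
-- of its vector.
lemma card_aperiodic_mul_le (hp : IsKasamiPrime p) (w : ℝ) :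
    p ^ (m + 1) * #{a : ZMod (p ^ (m + 1)) → ZMod 2 |
        ∃ v ∈ ball (ZMod (p ^ (m + 1)) ⊕ ZMod (p ^ (m + 1))) w, ¬ HasSmallPeriod v ∧ InCode a v} ≤
      2 * #(ball (ZMod (p ^ (m + 1)) ⊕ ZMod (p ^ (m + 1))) w) +
        ∑ M ∈ range m, 2 ^ p ^ (M + 1) *
          #{v ∈ ball (ZMod (p ^ (m + 1)) ⊕ ZMod (p ^ (m + 1))) w |
            FoldPeriodic (p ^ M) (p ^ (M + 1)) v} := by
  set S : Finset (ZMod (p ^ (m + 1)) ⊕ ZMod (p ^ (m + 1)) → ZMod 2) := ball _ w with hS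
  have h1 : p ^ (m + 1) * #{a : ZMod (p ^ (m + 1)) → ZMod 2 |
      ∃ v ∈ S, ¬ HasSmallPeriod v ∧ InCode a v} ≤
      ∑ a : ZMod (p ^ (m + 1)) → ZMod 2, #{v ∈ {v ∈ S | ¬ HasSmallPeriod v} | InCode a v} := by
    rw [mul_comm, ← smul_eq_mul]
    refine (Finset.card_nsmul_le_sum _ _ _ fun a ha => ?_).trans
      (Finset.sum_le_sum_of_subset (Finset.subset_univ _))
    obtain ⟨v, hvS, hv, hva⟩ := (mem_filter.1 ha).2
    have hcard : p ^ (m + 1) = #(univ : Finset (ZMod (p ^ (m + 1)))) := by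
      rw [Finset.card_univ, ZMod.card]
    conv_lhs => rw [hcard]
    refine Finset.card_le_card_of_injOn (fun t => v ∘ translate t) (fun t _ => ?_)
      (translate_injective hp.1 hv).injOn
    simp only [coe_filter, mem_filter, Set.mem_ofPred_eq]
    refine ⟨⟨(comp_perm_mem_ball _).2 hvS, fun hper => hv ?_⟩, hva.translate t⟩
    refine (translate t).surjective.injective_comp_right ?_
    refine Eq.trans ?_ hper
    change (v ∘ translate _) ∘ translate t = (v ∘ translate t) ∘ translate _
    rw [← comp_translate_add, ← comp_translate_add, add_comm t]
  have h2 := Finset.sum_card_bipartiteAbove_eq_sum_card_bipartiteBelow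
    (s := (univ : Finset (ZMod (p ^ (m + 1)) → ZMod 2))) (t := {v ∈ S | ¬ HasSmallPeriod v})
    InCode
  simp only [bipartiteAbove, bipartiteBelow] at h2
  rw [h2] at h1
  refine h1.trans ((Finset.sum_le_sum fun v hv =>
    card_inCode_le_sum hp (mem_filter.1 hv).2).trans ?_)
  refine (Finset.sum_le_sum_of_subset (Finset.filter_subset _ S)).trans ?_
  rw [Finset.sum_add_distrib, Finset.sum_comm, Finset.sum_const, smul_eq_mul, mul_comm]
  refine Nat.add_le_add_left (Finset.sum_le_sum fun M _ => ?_) _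
  rw [Finset.sum_ite, Finset.sum_const_zero, add_zero, Finset.sum_const, smul_eq_mul, mul_comm]

end

/-! ### Numerical estimates for aperiodic vectors -/

set_option exponentiation.threshold 2000 in
lemma chernoff_const_le :
    (2 * 7 ^ 225 * (8 / 7) ^ 1800 * (25 / 32) ^ 288 : ℝ) ≤ 2 ^ 882 := by
  rw [div_pow, div_pow]
  norm_num

/-- After raising to the power 900 each factor is bounded by the n-th power of a constant. The
product of the constants is at most 2^882, and the spare 2^(18n) pays for 10^(900m), as 10 ≤ 2^4 and
200m ≤ n. -/
lemma chernoff_le {n m a c : ℕ} {w : ℝ} (ha : 900 * a ≤ n) (hc : 32 * n ≤ 100 * c)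
    (hw : w ≤ n / 4) (hn : 200 * m ≤ n) :
    (2 : ℝ) ^ a * (7 ^ w * ((8 / 7) ^ (2 * n) * (25 / 32) ^ c)) ≤ 2 ^ n * (1 / 10) ^ m := by
  rw [← pow_le_pow_iff_left₀ (by positivity) (by positivity) (show 900 ≠ 0 by norm_num)]
  have h1 : ((2 : ℝ) ^ a) ^ 900 ≤ 2 ^ n := by
    rw [← pow_mul]
    exact pow_le_pow_right₀ (by norm_num) (by omega)
  have h2 : ((7 : ℝ) ^ w) ^ 900 ≤ (7 ^ 225) ^ n := by
    rw [← Real.rpow_natCast, ← Real.rpow_mul (by norm_num), ← pow_mul, ← Real.rpow_natCast 7]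
    refine Real.rpow_le_rpow_of_exponent_le (by norm_num) ?_
    push_cast
    linarith
  have h3 : (((8 / 7 : ℝ)) ^ (2 * n)) ^ 900 = ((8 / 7) ^ 1800) ^ n := by
    rw [← pow_mul, ← pow_mul]
    congr 1
    ring
  have h4 : (((25 / 32 : ℝ)) ^ c) ^ 900 ≤ ((25 / 32) ^ 288) ^ n := by
    rw [← pow_mul, ← pow_mul]
    exact pow_le_pow_of_le_one (by norm_num) (by norm_num) (by omega)
  have h5 : ((2 : ℝ) ^ 882) ^ n ≤ (2 ^ n * (1 / 10) ^ m) ^ 900 := by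
    have h6 : (10 : ℝ) ^ (900 * m) ≤ 2 ^ (18 * n) := by
      calc (10 : ℝ) ^ (900 * m) ≤ (2 ^ 4) ^ (900 * m) := by
            exact pow_le_pow_left₀ (by norm_num) (by norm_num) _
        _ = 2 ^ (4 * (900 * m)) := by rw [← pow_mul]
        _ ≤ 2 ^ (18 * n) := pow_le_pow_right₀ (by norm_num) (by omega)
    rw [one_div, inv_pow, mul_pow, inv_pow, ← pow_mul, ← pow_mul, ← pow_mul,
      ← div_eq_mul_inv, le_div_iff₀ (by positivity), mul_comm m]
    refine (mul_le_mul_of_nonneg_left h6 (by positivity)).trans_eq ?_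
    rw [← pow_add]
    congr 1
    ring
  refine le_trans ?_ h5
  calc ((2 : ℝ) ^ a * (7 ^ w * ((8 / 7) ^ (2 * n) * (25 / 32) ^ c))) ^ 900
      = (2 ^ a) ^ 900 * ((7 ^ w) ^ 900 * (((8 / 7) ^ (2 * n)) ^ 900 * ((25 / 32) ^ c) ^ 900)) := by
        rw [mul_pow, mul_pow, mul_pow]
    _ ≤ 2 ^ n * ((7 ^ 225) ^ n * (((8 / 7) ^ 1800) ^ n * ((25 / 32) ^ 288) ^ n)) := by
        rw [h3]
        gcongr
    _ = (2 * 7 ^ 225 * (8 / 7) ^ 1800 * (25 / 32) ^ 288) ^ n := by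
        rw [mul_pow, mul_pow, mul_pow]
        simp only [mul_assoc]
    _ ≤ (2 ^ 882) ^ n := pow_le_pow_left₀ (by positivity) chernoff_const_le n

/-- The product g·h is close to (2q'p/3)(ρ/2) = n/3 with n = q'pρ; 0.32 n leaves room for the
roundings. -/
lemma bundle_count_le {p q' ρ : ℕ} (hp : 2744 ≤ p) (hq : 1 ≤ q') (hρ : 2744 ≤ ρ) :
    32 * (q' * p * ρ) ≤ 100 * (2 * q' * (p - 1) / 3 * ((ρ - 1) / 2)) := by
  set g := 2 * q' * (p - 1) / 3 with hg
  set h := (ρ - 1) / 2 with hh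
  have h1 : 2 * q' * p ≤ 3 * g + 4 * q' := by
    obtain ⟨s, rfl⟩ : ∃ s, p = s + 1 := ⟨p - 1, by omega⟩
    rw [Nat.add_sub_cancel] at hg
    rw [Nat.mul_add]
    omega
  have h2 : ρ ≤ 2 * h + 2 := by omega
  have h3 : 1 * (q' * p) ≤ 2 * g := by nlinarith
  have h4 : 99 * (q' * p) ≤ 150 * g := by nlinarith
  have h5 : 99 * ρ ≤ 200 * h := by omega
  have h6 := Nat.mul_le_mul h4 h5
  nlinarith [Nat.zero_le (q' * p * ρ)]

lemma mul_le_prime_pow {p : ℕ} (hp : 2744 ≤ p) (m : ℕ) : 2744 * (m + 1) ≤ p ^ (m + 1) := by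
  induction m with
  | zero => simpa using hp
  | succ m ih =>
    rw [pow_succ]
    nlinarith

open Classical in
lemma card_foldPeriodic_mul_le {p m M : ℕ} [NeZero (p ^ (m + 1))] (hp : p.Prime) (hodd : Odd p)
    (hp' : 2744 ≤ p) (hM : M < m) {w : ℝ} (hw : w ≤ (p ^ (m + 1) : ℕ) / 4) :
    (2 : ℝ) ^ p ^ (M + 1) * #{v ∈ ball (ZMod (p ^ (m + 1)) ⊕ ZMod (p ^ (m + 1))) w |
        FoldPeriodic (p ^ M) (p ^ (M + 1)) v} ≤
      #(ball (ZMod (p ^ (m + 1)) ⊕ ZMod (p ^ (m + 1))) w) * (1 / 2) ^ (M + 1) +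
        2 ^ p ^ (m + 1) * (1 / 10) ^ (m + 1) := by
  have : NeZero (p ^ M) := ⟨pow_ne_zero _ hp.ne_zero⟩
  have hps : p = p - 1 + 1 := by omega
  have hs : Even (p - 1) := by
    obtain ⟨k, hk⟩ := hodd
    exact ⟨k, by omega⟩
  have hn : p ^ (m + 1) = p ^ (M + 1) * p ^ (m - M) := by
    rw [← pow_add]
    congr 1
    omega
  have hρ : 2744 ≤ p ^ (m - M) := hp'.trans (Nat.le_self_pow (by omega) p)
  have hq1 : 1 ≤ p ^ M := NeZero.one_le
  have hbound := card_foldPeriodic_le (q' := p ^ M) (s := p - 1) (q := p ^ (M + 1))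
    (ρ := p ^ (m - M)) (h := (p ^ (m - M) - 1) / 2) (n := p ^ (m + 1)) hs
    (by rw [← hps, pow_succ]) hn (by omega) w (2 * p ^ M * (p - 1) / 3)
  set D := 2 * p ^ M * (p - 1) with hD
  have hDq : D + 2 * p ^ M = 2 * p ^ (M + 1) := by
    rw [hD, ← Nat.mul_succ, Nat.succ_eq_add_one, ← hps, pow_succ, mul_assoc]
  have hMq : M < p ^ M := Nat.lt_pow_self hp.one_lt
  have hqp : 2744 * p ^ M ≤ p ^ (M + 1) := by
    rw [pow_succ, mul_comm]
    exact Nat.mul_le_mul_left _ hp'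
  refine (mul_le_mul_of_nonneg_left hbound (pow_nonneg zero_le_two _)).trans ?_
  rw [mul_add]
  refine add_le_add ?_ ?_
  · rw [mul_left_comm]
    refine mul_le_mul_of_nonneg_left ?_ (Nat.cast_nonneg _)
    -- Two thirds of the D bundles is about (4/3) p^(M+1), which beats the number 2^(p^(M+1)) of
    -- columns.
    have hle : p ^ (M + 1) + (M + 1) ≤ D - D / 3 := by omega
    calc (2 : ℝ) ^ p ^ (M + 1) * (1 / 2) ^ (D - D / 3)
        ≤ 2 ^ p ^ (M + 1) * (1 / 2) ^ (p ^ (M + 1) + (M + 1)) := by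
          refine mul_le_mul_of_nonneg_left ?_ (by positivity)
          exact pow_le_pow_of_le_one (by norm_num) (by norm_num) hle
      _ = (1 / 2) ^ (M + 1) := by
          rw [pow_add (1 / 2 : ℝ), ← mul_assoc, ← mul_pow]
          norm_num
  · rw [← mul_assoc, ← pow_add]
    have hge := mul_le_prime_pow hp' m
    refine chernoff_le ?_ ?_ hw (by omega)
    · have h1 : 3 * p ^ (M + 1) * 2744 ≤ 3 * p ^ (m + 1) := by
        rw [hn, mul_assoc]
        exact Nat.mul_le_mul_left _ (Nat.mul_le_mul_left _ hρ)
      omega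
    · have := bundle_count_le hp' hq1 hρ
      rwa [← pow_succ, ← hn] at this

lemma sum_half_pow_le (m : ℕ) : ∑ M ∈ range m, (1 / 2 : ℝ) ^ (M + 1) ≤ 1 := by
  have h : ∑ M ∈ range m, (1 / 2 : ℝ) ^ (M + 1) = 1 - (1 / 2) ^ m := by
    induction m with
    | zero => simp
    | succ m ih =>
      rw [Finset.sum_range_succ, ih]
      ring
  rw [h]
  have : (0 : ℝ) ≤ (1 / 2) ^ m := by positivity
  linarith

open Classical in
lemma card_aperiodic_le {p m : ℕ} [NeZero (p ^ (m + 1))] (hp : IsKasamiPrime p)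
    (hp' : 2744 ≤ p) {w : ℝ} (hw : w ≤ (p ^ (m + 1) : ℕ) / 4) :
    (p ^ (m + 1) : ℕ) * (#{a : ZMod (p ^ (m + 1)) → ZMod 2 |
        ∃ v ∈ ball (ZMod (p ^ (m + 1)) ⊕ ZMod (p ^ (m + 1))) w,
          ¬ HasSmallPeriod v ∧ InCode a v} : ℝ) ≤
      3 * #(ball (ZMod (p ^ (m + 1)) ⊕ ZMod (p ^ (m + 1))) w) +
        (p ^ (m + 1) : ℕ) * (2 ^ p ^ (m + 1) * (1 / 10) ^ (m + 1)) := by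
  have h1 : (p ^ (m + 1) : ℕ) * (#{a : ZMod (p ^ (m + 1)) → ZMod 2 |
        ∃ v ∈ ball (ZMod (p ^ (m + 1)) ⊕ ZMod (p ^ (m + 1))) w,
          ¬ HasSmallPeriod v ∧ InCode a v} : ℝ) ≤
      2 * #(ball (ZMod (p ^ (m + 1)) ⊕ ZMod (p ^ (m + 1))) w) +
        ∑ M ∈ range m, (2 : ℝ) ^ p ^ (M + 1) *
          #{v ∈ ball (ZMod (p ^ (m + 1)) ⊕ ZMod (p ^ (m + 1))) w |
            FoldPeriodic (p ^ M) (p ^ (M + 1)) v} := by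
    exact_mod_cast card_aperiodic_mul_le hp w
  have h2 := Finset.sum_le_sum fun M (hM : M ∈ range m) =>
    card_foldPeriodic_mul_le hp.1 hp.odd hp' (mem_range.1 hM) hw
  rw [Finset.sum_add_distrib, ← Finset.mul_sum, Finset.sum_const, card_range, nsmul_eq_mul] at h2
  have h3 : (#(ball (ZMod (p ^ (m + 1)) ⊕ ZMod (p ^ (m + 1))) w) : ℝ) *
      ∑ M ∈ range m, (1 / 2 : ℝ) ^ (M + 1) ≤
      #(ball (ZMod (p ^ (m + 1)) ⊕ ZMod (p ^ (m + 1))) w) :=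
    mul_le_of_le_one_right (by positivity) (sum_half_pow_le m)
  have h4 : (m : ℝ) * (2 ^ p ^ (m + 1) * (1 / 10) ^ (m + 1)) ≤
      (p ^ (m + 1) : ℕ) * (2 ^ p ^ (m + 1) * (1 / 10) ^ (m + 1)) := by
    refine mul_le_mul_of_nonneg_right ?_ (by positivity)
    have := mul_le_prime_pow hp' m
    exact_mod_cast (show m ≤ p ^ (m + 1) by omega)
  linarith

/-! ### Reduction of the length -/

section

variable {n N : ℕ} [NeZero n] [NeZero N]

open Classical in
/-- The first columns `a` whose code has a nonzero word of weight at most `w`. -/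
noncomputable def badColumns (n : ℕ) [NeZero n] (w : ℝ) : Finset (ZMod n → ZMod 2) :=
  {a | ∃ v ∈ ball (ZMod n ⊕ ZMod n) w, InCode a v}

lemma mem_badColumns {w : ℝ} {a : ZMod n → ZMod 2} :
    a ∈ badColumns n w ↔ ∃ v ∈ ball (ZMod n ⊕ ZMod n) w, InCode a v := by
  simp [badColumns]

lemma natCast_val_eq_castHom (h : N ∣ n) (i : ZMod n) :
    (i.val : ZMod N) = ZMod.castHom h (ZMod N) i := by
  conv_rhs => rw [← ZMod.natCast_zmod_val i, map_natCast]

lemma eq_comp_castHom_of_period (h : N ∣ n) {v : ZMod n ⊕ ZMod n → ZMod 2}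
    (hv : v ∘ translate (N : ZMod n) = v) :
    ∃ v' : ZMod N ⊕ ZMod N → ZMod 2,
      v = v' ∘ Sum.map (ZMod.castHom h (ZMod N)) (ZMod.castHom h (ZMod N)) := by
  refine ⟨v ∘ Sum.map (fun i => (i.val : ZMod n)) (fun i => (i.val : ZMod n)), ?_⟩
  have hmod : ∀ i : ZMod n, ((ZMod.castHom h (ZMod N) i).val : ZMod n) +
      ((i.val / N : ℕ) : ZMod n) * (N : ZMod n) = i := by
    intro i
    rw [← natCast_val_eq_castHom h, ZMod.val_natCast, ← Nat.cast_mul, ← Nat.cast_add,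
      Nat.mod_add_div', ZMod.natCast_zmod_val]
  have hper := fun i => congrFun (comp_translate_mul hv ((i : ℕ) : ZMod n))
  ext (i | i)
  · have := hper (i.val / N) (.inl ((ZMod.castHom h (ZMod N) i).val : ZMod n))
    simp only [Function.comp_apply, translate, Equiv.sumCongr_apply, Sum.map_inl,
      Equiv.coe_addRight, hmod] at this
    rw [this]
    rfl
  · have := hper (i.val / N) (.inr ((ZMod.castHom h (ZMod N) i).val : ZMod n))
    simp only [Function.comp_apply, translate, Equiv.sumCongr_apply, Sum.map_inr,
      Equiv.coe_addRight, hmod] at this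
    rw [this]
    rfl

/-- Convolving a with a vector constant on the fibres of reduction modulo N only sees the sums of a
over these fibres. -/
lemma InCode.of_comp_castHom (h : N ∣ n) {a : ZMod n → ZMod 2} {v' : ZMod N ⊕ ZMod N → ZMod 2}
    (hv : InCode a (v' ∘ Sum.map (ZMod.castHom h (ZMod N)) (ZMod.castHom h (ZMod N)))) :
    InCode (fold N a) v' := by
  intro c
  obtain ⟨i, rfl⟩ := ZMod.castHom_surjective h c
  rw [← hv i]
  refine congrArg₂ _ rfl ?_
  have h1 : ∑ j : ZMod n, a (i - j) * (v' ∘ Sum.map (ZMod.castHom h (ZMod N))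
      (ZMod.castHom h (ZMod N))) (.inr j) =
      ∑ k : ZMod n, a k * v' (.inr (ZMod.castHom h (ZMod N) i - ZMod.castHom h (ZMod N) k)) := by
    refine Fintype.sum_equiv (Equiv.subLeft i) _ _ fun j => ?_
    simp only [Equiv.subLeft_apply, Function.comp_apply, Sum.map_inr, map_sub, sub_sub_cancel]
  have h2 : ∑ j : ZMod N, fold N a (ZMod.castHom h (ZMod N) i - j) * v' (.inr j) =
      ∑ c : ZMod N, fold N a c * v' (.inr (ZMod.castHom h (ZMod N) i - c)) := by
    refine Fintype.sum_equiv (Equiv.subLeft (ZMod.castHom h (ZMod N) i)) _ _ fun j => ?_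
    simp
  rw [h1, h2]
  simp only [fold, Finset.sum_mul]
  rw [Finset.sum_comm]
  refine Finset.sum_congr rfl fun k _ => ?_
  simp only [natCast_val_eq_castHom h, ite_mul, zero_mul]
  rw [Finset.sum_ite_eq, if_pos (mem_univ _)]

lemma card_castHom_fiber (h : N ∣ n) (c : ZMod N) :
    #{i : ZMod n | ZMod.castHom h (ZMod N) i = c} = n / N := by
  have key : ∀ c : ZMod N, #{i : ZMod n | ZMod.castHom h (ZMod N) i = c} =
      #{i : ZMod n | ZMod.castHom h (ZMod N) i = 0} := by
    intro c
    obtain ⟨j, rfl⟩ := ZMod.castHom_surjective h c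
    refine Finset.card_bij (fun i _ => i - j) (fun i hi => ?_)
      (fun _ _ _ _ hij => sub_left_injective hij) fun i hi => ⟨i + j, ?_, by simp⟩
    · simp only [mem_filter, mem_univ, true_and] at hi ⊢
      rw [map_sub, hi, sub_self]
    · simp only [mem_filter, mem_univ, true_and] at hi ⊢
      rw [map_add, hi, zero_add]
  have hsum := Finset.card_eq_sum_card_fiberwise (f := ZMod.castHom h (ZMod N))
    (s := (univ : Finset (ZMod n))) (t := univ) (fun _ _ => mem_coe.2 (mem_univ _))
  rw [Finset.sum_congr rfl fun c _ => key c, Finset.sum_const, card_univ, card_univ, ZMod.card,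
    ZMod.card, smul_eq_mul] at hsum
  rw [key c]
  exact (Nat.div_eq_of_eq_mul_right (NeZero.pos N) hsum).symm

lemma sum_comp_castHom (h : N ∣ n) (g : ZMod N → ℕ) :
    ∑ i, g (ZMod.castHom h (ZMod N) i) = n / N * ∑ c, g c := by
  rw [← Finset.sum_fiberwise univ (ZMod.castHom h (ZMod N)), Finset.mul_sum]
  refine Finset.sum_congr rfl fun c _ => ?_
  rw [Finset.sum_congr rfl fun i hi => congrArg g (mem_filter.1 hi).2, Finset.sum_const,
    card_castHom_fiber, smul_eq_mul]

lemma hammingNorm_comp_castHom (h : N ∣ n) (v' : ZMod N ⊕ ZMod N → ZMod 2) :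
    hammingNorm (v' ∘ Sum.map (ZMod.castHom h (ZMod N)) (ZMod.castHom h (ZMod N))) =
      n / N * hammingNorm v' := by
  rw [hammingNorm, hammingNorm, Finset.card_filter, Finset.card_filter, Fintype.sum_sum_type,
    Fintype.sum_sum_type, mul_add, ← sum_comp_castHom h, ← sum_comp_castHom h]
  rfl

/-- The entries at positions from N on are free; together with the fold they determine the first N
entries, which lie in distinct residue classes. -/
lemma card_fold_mem_le (S : Finset (ZMod N → ZMod 2)) :
    #{a : ZMod n → ZMod 2 | fold N a ∈ S} ≤ #S * 2 ^ (n - N) := by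
  have hcard : #S * 2 ^ (n - N) = #(S ×ˢ (univ : Finset (Fin (n - N) → ZMod 2))) := by
    rw [card_product, card_univ, Fintype.card_fun, ZMod.card, Fintype.card_fin]
  rw [hcard]
  refine Finset.card_le_card_of_injOn (fun a => (fold N a, fun k => a ((N + k : ℕ) : ZMod n)))
    (fun a ha => mem_coe.2 (mem_product.2 ⟨(mem_filter.1 (mem_coe.1 ha)).2, mem_univ _⟩)) ?_
  intro a _ b _ hab
  have hfold := (Prod.mk.inj hab).1
  have htail : ∀ i : ZMod n, N ≤ i.val → a i = b i := by
    intro i hi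
    have := congrFun (Prod.mk.inj hab).2 ⟨i.val - N, by have := i.val_lt; omega⟩
    simpa only [Nat.add_sub_of_le hi, ZMod.natCast_zmod_val] using this
  have hsub : ∀ c : ZMod N, fold N (a - b) c = 0 := by
    intro c
    have := congrFun hfold c
    rw [fold, fold, ← sub_eq_zero, ← Finset.sum_sub_distrib] at this
    refine Eq.trans (Finset.sum_congr rfl fun i _ => ?_) this
    split_ifs <;> simp
  ext i
  rcases le_or_gt N i.val with hi | hi
  · rw [htail i hi]
  · have h1 := hsub (i.val : ZMod N)
    rw [fold, Finset.sum_eq_single i] at h1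
    · rw [if_pos rfl] at h1
      rw [sub_eq_zero.1 h1]
    · intro j _ hj
      rcases le_or_gt N j.val with hj' | hj'
      · simp [htail j hj']
      · refine if_neg fun hij => hj ?_
        rw [ZMod.natCast_eq_natCast_iff', Nat.mod_eq_of_lt hi, Nat.mod_eq_of_lt hj'] at hij
        exact ZMod.val_injective n hij
    · simp

open Classical in
lemma card_periodic_le (h : N ∣ n) (w : ℝ) :
    #{a : ZMod n → ZMod 2 | ∃ v ∈ ball (ZMod n ⊕ ZMod n) w,
      v ∘ translate (N : ZMod n) = v ∧ InCode a v} ≤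
      #(badColumns N (w / (n / N : ℕ))) * 2 ^ (n - N) := by
  refine le_trans (Finset.card_le_card fun a ha => ?_)
    (card_fold_mem_le (badColumns N (w / (n / N : ℕ))))
  obtain ⟨v, hv, hper, hcode⟩ := (mem_filter.1 ha).2
  obtain ⟨v', rfl⟩ := eq_comp_castHom_of_period h hper
  obtain ⟨hne, hle⟩ := mem_ball.1 hv
  refine mem_filter.2 ⟨mem_univ _, mem_badColumns.2 ⟨v', mem_ball.2 ⟨?_, ?_⟩,
    hcode.of_comp_castHom h⟩⟩
  · rintro rfl
    exact hne rfl
  · have hpos : 0 < n / N := Nat.div_pos (Nat.le_of_dvd (NeZero.pos n) h) (NeZero.pos N)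
    rw [hammingNorm_comp_castHom, Nat.cast_mul] at hle
    rw [le_div_iff₀ (by exact_mod_cast hpos)]
    linarith

end

open Classical in
/-- The proportion of bad columns for the length `p ^ (m + 1)` is controlled by the number of
vectors of small weight and by the proportion of bad columns for the length `p ^ m`. -/
lemma card_badColumns_succ_le {p m : ℕ} [NeZero (p ^ (m + 1))] [NeZero (p ^ m)]
    (hp : IsKasamiPrime p) (hp' : 2744 ≤ p) {w : ℝ} (hw : w ≤ (p ^ (m + 1) : ℕ) / 4) :
    (#(badColumns (p ^ (m + 1)) w) : ℝ) / 2 ^ p ^ (m + 1) ≤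
      3 * (#(ball (ZMod (p ^ (m + 1)) ⊕ ZMod (p ^ (m + 1))) w) /
          ((p ^ (m + 1) : ℕ) * 2 ^ p ^ (m + 1))) + (1 / 10) ^ (m + 1) +
        #(badColumns (p ^ m) (w / p)) / 2 ^ p ^ m := by
  have hdvd : p ^ m ∣ p ^ (m + 1) := pow_dvd_pow p m.le_succ
  have hdiv : p ^ (m + 1) / p ^ m = p := by
    rw [pow_succ, Nat.mul_div_cancel_left _ (NeZero.pos _)]
  have hle : p ^ m ≤ p ^ (m + 1) := Nat.le_of_dvd (NeZero.pos _) hdvd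
  have h1 := card_aperiodic_le hp hp' hw
  have h2 := card_periodic_le hdvd w
  rw [hdiv] at h2
  have h3 : #(badColumns (p ^ (m + 1)) w) ≤
      #{a : ZMod (p ^ (m + 1)) → ZMod 2 |
        ∃ v ∈ ball (ZMod (p ^ (m + 1)) ⊕ ZMod (p ^ (m + 1))) w,
          ¬ HasSmallPeriod v ∧ InCode a v} +
      #{a : ZMod (p ^ (m + 1)) → ZMod 2 |
        ∃ v ∈ ball (ZMod (p ^ (m + 1)) ⊕ ZMod (p ^ (m + 1))) w,
          v ∘ translate ((p ^ m : ℕ) : ZMod (p ^ (m + 1))) = v ∧ InCode a v} := by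
    refine le_trans (Finset.card_le_card fun a ha => ?_) (Finset.card_union_le _ _)
    obtain ⟨v, hv, hcode⟩ := mem_badColumns.1 ha
    rw [mem_union, mem_filter, mem_filter]
    by_cases hper : HasSmallPeriod v
    · exact Or.inr ⟨mem_univ _, v, hv, hper, hcode⟩
    · exact Or.inl ⟨mem_univ _, v, hv, hper, hcode⟩
  set A := #{a : ZMod (p ^ (m + 1)) → ZMod 2 |
        ∃ v ∈ ball (ZMod (p ^ (m + 1)) ⊕ ZMod (p ^ (m + 1))) w,
          ¬ HasSmallPeriod v ∧ InCode a v}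
  set P := #{a : ZMod (p ^ (m + 1)) → ZMod 2 |
        ∃ v ∈ ball (ZMod (p ^ (m + 1)) ⊕ ZMod (p ^ (m + 1))) w,
          v ∘ translate ((p ^ m : ℕ) : ZMod (p ^ (m + 1))) = v ∧ InCode a v}
  clear_value A P
  generalize #(badColumns (p ^ (m + 1)) w) = b at h3 ⊢
  generalize #(badColumns (p ^ m) (w / p)) = b' at h2 ⊢
  generalize #(ball (ZMod (p ^ (m + 1)) ⊕ ZMod (p ^ (m + 1))) w) = B at h1 ⊢
  have hn0 : (0 : ℝ) < (p ^ (m + 1) : ℕ) := by exact_mod_cast NeZero.pos (p ^ (m + 1))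
  generalize p ^ (m + 1) = n at *
  generalize p ^ m = N at *
  have h2' : (P : ℝ) ≤ b' * 2 ^ (n - N) := by exact_mod_cast h2
  have h3' : (b : ℝ) ≤ A + P := by exact_mod_cast h3
  have hA : (A : ℝ) / 2 ^ n ≤ 3 * (B / (n * 2 ^ n)) + (1 / 10) ^ (m + 1) := by
    rw [div_le_iff₀ (by positivity)]
    refine le_of_mul_le_mul_left (h1.trans_eq ?_) hn0
    field_simp
  have hP : (P : ℝ) / 2 ^ n ≤ b' / 2 ^ N := by
    rw [div_le_div_iff₀ (by positivity) (by positivity)]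
    refine (mul_le_mul_of_nonneg_right h2' (by positivity)).trans_eq ?_
    rw [mul_assoc, ← pow_add, Nat.sub_add_cancel hle]
  calc (b : ℝ) / 2 ^ n ≤ (A + P) / 2 ^ n := by gcongr
    _ = A / 2 ^ n + P / 2 ^ n := add_div _ _ _
    _ ≤ _ := add_le_add hA hP

/-! ### Estimates for Hamming balls -/

section Ball

variable {I J : Type*} [Fintype I] [DecidableEq I] [Fintype J] [DecidableEq J]

lemma card_ball_congr (e : I ≃ J) (w : ℝ) : #(ball I w) = #(ball J w) := by
  refine Finset.card_bij (fun x _ => x ∘ e.symm) (fun x hx => ?_)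
    (fun x _ y _ h => e.symm.surjective.injective_comp_right h) fun y hy => ⟨y ∘ e, ?_, ?_⟩
  · rw [mem_ball] at hx ⊢
    rw [hammingNorm_comp_equiv]
    refine ⟨fun h => hx.1 ?_, hx.2⟩
    ext i
    simpa using congrFun h (e i)
  · rw [mem_ball] at hy ⊢
    rw [hammingNorm_comp_equiv]
    refine ⟨fun h => hy.1 ?_, hy.2⟩
    ext i
    simpa using congrFun h (e.symm i)
  · ext i
    simp

lemma choose_le_card_ball {k : ℕ} (hk : k ≠ 0) {w : ℝ} (hw : (k : ℝ) ≤ w) :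
    (Fintype.card I).choose k ≤ #(ball I w) := by
  rw [← Finset.card_univ, ← card_powersetCard]
  have hsupp : ∀ s : Finset I,
      ({i | (if i ∈ s then (1 : ZMod 2) else 0) ≠ 0} : Finset I) = s := by
    intro s
    ext i
    simp
  refine Finset.card_le_card_of_injOn (fun s i => if i ∈ s then 1 else 0) (fun s hs => ?_) ?_
  · have hs := (mem_powersetCard.1 (mem_coe.1 hs)).2
    have hnorm : hammingNorm (fun i => if i ∈ s then (1 : ZMod 2) else 0) = k := by
      rw [hammingNorm, hsupp, hs]
    rw [mem_coe, mem_ball, hnorm]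
    refine ⟨?_, hw⟩
    rw [← hammingNorm_ne_zero_iff, hnorm]
    exact hk
  · intro s _ t _ hst
    rw [← hsupp s, ← hsupp t]
    ext i
    rw [mem_filter, mem_filter]
    have := congrFun hst i
    simp only at this
    rw [this]

lemma card_ball_pow_le {R : ℕ} (hR : 0 < R) (w : ℝ) :
    #(ball I (w / R)) ^ R ≤ #(ball (Fin R × I) w) := by
  have hcard : #(ball I (w / R)) ^ R = #(Fintype.piFinset fun _ : Fin R => ball I (w / R)) := by
    rw [Fintype.card_piFinset, Finset.prod_const, card_univ, Fintype.card_fin]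
  rw [hcard]
  refine Finset.card_le_card_of_injOn (fun f => Function.uncurry f) (fun f hf => ?_)
    (Function.uncurry_injective.injOn)
  have hf := fun k => mem_ball.1 (Fintype.mem_piFinset.1 (mem_coe.1 hf) k)
  have hnorm : hammingNorm (Function.uncurry f) = ∑ k, hammingNorm (f k) := by
    rw [hammingNorm, Finset.card_filter, Fintype.sum_prod_type]
    refine Finset.sum_congr rfl fun k _ => ?_
    rw [hammingNorm, Finset.card_filter]
    rfl
  rw [mem_coe, mem_ball]
  constructor
  · intro h0
    refine (hf ⟨0, hR⟩).1 ?_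
    funext i
    exact congrFun h0 (⟨0, hR⟩, i)
  · rw [hnorm, Nat.cast_sum]
    refine (Finset.sum_le_card_nsmul _ _ (w / R) fun k _ => (hf k).2).trans_eq ?_
    rw [card_univ, Fintype.card_fin, nsmul_eq_mul]
    field_simp

end Ball

lemma choose_pow_le (a b c : ℕ) : a.choose b ^ c ≤ (a * c).choose (b * c) := by
  induction c with
  | zero => simp
  | succ c ih =>
    rw [pow_succ, Nat.mul_succ, Nat.mul_succ, Nat.add_choose_eq]
    refine (Nat.mul_le_mul_right _ ih).trans ?_
    exact Finset.single_le_sum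
      (f := fun ij : ℕ × ℕ => (a * c).choose ij.1 * a.choose ij.2) (fun _ _ => Nat.zero_le _)
      (mem_antidiagonal.2 (rfl : (b * c, b).1 + (b * c, b).2 = b * c + b))

lemma two_pow_le_choose : 2 ^ 83 ≤ Nat.choose 160 20 := by
  rw [Nat.choose_eq_descFactorial_div_factorial]
  norm_num [Nat.descFactorial, Nat.factorial]

lemma linear_mul_two_pow_le {c : ℕ} (hc : 34 ≤ c) : (80 * c + 80) * 2 ^ 79 ≤ 2 ^ (3 * c) := by
  induction c, hc using Nat.le_induction with
  | base => norm_num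
  | succ c hc ih =>
    calc (80 * (c + 1) + 80) * 2 ^ 79 ≤ (80 * c + 80) * 2 ^ 3 * 2 ^ 79 :=
          Nat.mul_le_mul_right _ (by omega)
      _ = (80 * c + 80) * 2 ^ 79 * 2 ^ 3 := mul_right_comm _ _ _
      _ ≤ 2 ^ (3 * c) * 2 ^ 3 := Nat.mul_le_mul_right _ ih
      _ = 2 ^ (3 * (c + 1)) := by rw [← pow_add, Nat.mul_succ 3]

/-- Each block of 80 in n yields a factor C(160, 20) ≥ 2^83. The 3 spare bits per block pay for the
factor n and for the remainder of n modulo 80 once there are 34 blocks. -/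
lemma mul_two_pow_lt_choose {n : ℕ} (hn : 2744 ≤ n) :
    n * 2 ^ n < (2 * n).choose (20 * (n / 80)) := by
  set c := n / 80 with hc
  have hc34 : 34 ≤ c := by omega
  calc n * 2 ^ n < (80 * c + 80) * 2 ^ (79 + 80 * c) := by
        refine Nat.mul_lt_mul_of_lt_of_le (by omega) (Nat.pow_le_pow_right two_pos (by omega))
          (by positivity)
    _ = (80 * c + 80) * 2 ^ 79 * 2 ^ (80 * c) := by rw [pow_add, mul_assoc]
    _ ≤ 2 ^ (3 * c) * 2 ^ (80 * c) := Nat.mul_le_mul_right _ (linear_mul_two_pow_le hc34)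
    _ = (2 ^ 83) ^ c := by
        rw [← pow_add, ← pow_mul]
        congr 1
        ring
    _ ≤ (Nat.choose 160 20) ^ c := Nat.pow_le_pow_left two_pow_le_choose c
    _ ≤ (160 * c).choose (20 * c) := choose_pow_le _ _ _
    _ ≤ (2 * n).choose (20 * c) := Nat.choose_le_choose _ (by omega)

section

variable {n : ℕ} [NeZero n]

lemma card_zmod_sum : Fintype.card (ZMod n ⊕ ZMod n) = 2 * n := by
  rw [Fintype.card_sum, ZMod.card, two_mul]

lemma le_quarter_of_card_ball_le (hn : 2744 ≤ n) {w : ℝ}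
    (h : (#(ball (ZMod n ⊕ ZMod n) w) : ℝ) ≤ n * 2 ^ n) : w ≤ n / 4 := by
  by_contra! hlt
  have hk : ((20 * (n / 80) : ℕ) : ℝ) ≤ w := by
    have h1 : 4 * (20 * (n / 80)) ≤ n := by omega
    have h2 : 4 * ((20 * (n / 80) : ℕ) : ℝ) ≤ n := by exact_mod_cast h1
    linarith
  have h3 := choose_le_card_ball (I := ZMod n ⊕ ZMod n) (by omega) hk
  rw [card_zmod_sum] at h3
  have h4 := (mul_two_pow_lt_choose hn).trans_le h3
  have h5 : (n : ℝ) * 2 ^ n < #(ball (ZMod n ⊕ ZMod n) w) := by exact_mod_cast h4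
  linarith

lemma card_ball_pow_le_of_mul {N R : ℕ} [NeZero N] (hR : 0 < R) (hn : n = N * R) (w : ℝ) :
    #(ball (ZMod N ⊕ ZMod N) (w / R)) ^ R ≤ #(ball (ZMod n ⊕ ZMod n) w) := by
  refine (card_ball_pow_le hR w).trans_eq (card_ball_congr (Fintype.equivOfCardEq ?_) w)
  rw [Fintype.card_prod, card_zmod_sum, card_zmod_sum, Fintype.card_fin, hn]
  ring

end

/-- For a proper divisor of the length the number of vectors of proportional weight is small. -/
lemma card_ball_prime_pow_le {p m j : ℕ} [NeZero (p ^ m)] [NeZero (p ^ j)] (hp : 2744 ≤ p)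
    (hj : j < m) {w : ℝ}
    (h : (#(ball (ZMod (p ^ m) ⊕ ZMod (p ^ m)) w) : ℝ) ≤ (p ^ m : ℕ) * 2 ^ p ^ m) :
    (#(ball (ZMod (p ^ j) ⊕ ZMod (p ^ j)) (w / (p ^ (m - j) : ℕ))) : ℝ) ≤
      2 * ((p ^ j : ℕ) * 2 ^ p ^ j) / 52 ^ j := by
  have hn : p ^ m = p ^ j * p ^ (m - j) := by
    rw [← pow_add]
    congr 1
    omega
  have hR : 2 ≤ p ^ (m - j) := le_trans (by omega) (Nat.le_self_pow (by omega : m - j ≠ 0) p)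
  have hpow := card_ball_pow_le_of_mul (N := p ^ j) (by omega) hn w
  by_contra! hlt
  -- As 52² = 2704 ≤ p, t = N/52^j is at least √N. Then (2t)^R ≥ R·t² ≥ RN for R ≥ 2, contradicting
  -- b^R ≤ RN·2^(RN) if b > 2t·2^N.
  have hN : ((52 : ℝ) ^ j) ^ 2 ≤ (p ^ j : ℕ) := by
    rw [← pow_mul, mul_comm, pow_mul]
    push_cast
    refine pow_le_pow_left₀ (by norm_num) ?_ j
    have : (2744 : ℝ) ≤ p := by exact_mod_cast hp
    linarith
  generalize #(ball (ZMod (p ^ j) ⊕ ZMod (p ^ j)) (w / (p ^ (m - j) : ℕ))) = b at hpow hlt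
  generalize #(ball (ZMod (p ^ m) ⊕ ZMod (p ^ m)) w) = B at hpow h
  have hpow' : (b : ℝ) ^ p ^ (m - j) ≤ B := by exact_mod_cast hpow
  have hn' : ((p ^ m : ℕ) : ℝ) = (p ^ j : ℕ) * (p ^ (m - j) : ℕ) := by exact_mod_cast hn
  rw [hn'] at h
  rw [hn] at h
  generalize p ^ (m - j) = R at *
  generalize p ^ j = N at *
  set t : ℝ := N / 52 ^ j with ht
  have h52 : (0 : ℝ) < 52 ^ j := by positivity
  have hone : (1 : ℝ) ≤ 52 ^ j := one_le_pow₀ (by norm_num)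
  have htN : (N : ℝ) ≤ t ^ 2 := by
    rw [ht, div_pow, le_div_iff₀ (by positivity), pow_two (N : ℝ)]
    exact mul_le_mul_of_nonneg_left hN (Nat.cast_nonneg N)
  have ht1 : 1 ≤ t := by
    rw [ht, le_div_iff₀ h52]
    nlinarith
  have hb : 2 * t * 2 ^ N < (b : ℝ) := by
    refine lt_of_eq_of_lt ?_ hlt
    rw [ht]
    ring
  have h1 : (2 * t * 2 ^ N) ^ R < (b : ℝ) ^ R :=
    pow_lt_pow_left₀ hb (by positivity) (by omega)
  have h2 : (R : ℝ) ≤ 2 ^ R := by exact_mod_cast R.lt_two_pow_self.le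
  have h3 : (N : ℝ) ≤ t ^ R := htN.trans (pow_le_pow_right₀ ht1 hR)
  have h4 : (N : ℝ) * R * 2 ^ (N * R) ≤ (2 * t * 2 ^ N) ^ R := by
    rw [mul_pow, mul_pow, ← pow_mul]
    refine mul_le_mul_of_nonneg_right ?_ (by positivity)
    rw [mul_comm]
    exact mul_le_mul h2 h3 (by positivity) (by positivity)
  linarith

/-! ### Existence of a good first column -/

lemma badColumns_one_eq_empty {p : ℕ} [NeZero (p ^ 0)] {w : ℝ} (hw : w < 1) :
    badColumns (p ^ 0) w = ∅ := by
  rw [Finset.eq_empty_iff_forall_notMem]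
  intro a ha
  obtain ⟨v, hv, -⟩ := mem_badColumns.1 ha
  obtain ⟨hne, hle⟩ := mem_ball.1 hv
  have h1 : (1 : ℝ) ≤ hammingNorm v := by exact_mod_cast hammingNorm_pos_iff.2 hne
  linarith

lemma card_badColumns_le {p m : ℕ} [NeZero p] (hp : IsKasamiPrime p) (hp' : 2744 ≤ p) {w : ℝ}
    (h : (#(ball (ZMod (p ^ m) ⊕ ZMod (p ^ m)) w) : ℝ) ≤ (p ^ m : ℕ) * 2 ^ p ^ m)
    (hw : w ≤ (p ^ m : ℕ) / 4) {j : ℕ} (hj : j < m) :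
    (#(badColumns (p ^ j) (w / (p ^ (m - j) : ℕ))) : ℝ) / 2 ^ p ^ j ≤
      1 / 4 - 1 / 4 * (1 / 8) ^ j := by
  have hp0 : (0 : ℝ) < p := by exact_mod_cast NeZero.pos p
  have hquarter : ∀ j ≤ m, w / (p ^ (m - j) : ℕ) ≤ (p ^ j : ℕ) / 4 := by
    intro j hj
    rw [div_le_iff₀ (by push_cast; positivity)]
    refine hw.trans_eq ?_
    push_cast
    rw [div_mul_eq_mul_div, ← pow_add, Nat.add_sub_cancel' hj]
  induction j with
  | zero =>
    have h0 := hquarter 0 (Nat.zero_le _)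
    -- At length 1 the scaled radius is at most 1/4, so the ball is empty.
    rw [badColumns_one_eq_empty (lt_of_le_of_lt h0 (by norm_num))]
    norm_num
  | succ j ih =>
    have hstep := card_badColumns_succ_le hp hp' (hquarter (j + 1) hj.le)
    have hball := card_ball_prime_pow_le hp' hj h
    have hdiv : w / (p ^ (m - (j + 1)) : ℕ) / p = w / (p ^ (m - j) : ℕ) := by
      rw [div_div, show m - j = m - (j + 1) + 1 by omega, pow_succ]
      push_cast
      rfl
    rw [hdiv] at hstep
    have hpos : (0 : ℝ) < (p ^ (j + 1) : ℕ) * 2 ^ p ^ (j + 1) := by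
      have : (0 : ℝ) < (p ^ (j + 1) : ℕ) := by exact_mod_cast NeZero.pos (p ^ (j + 1))
      positivity
    have hratio : (#(ball (ZMod (p ^ (j + 1)) ⊕ ZMod (p ^ (j + 1)))
        (w / (p ^ (m - (j + 1)) : ℕ))) : ℝ) / ((p ^ (j + 1) : ℕ) * 2 ^ p ^ (j + 1)) ≤
        2 / 52 ^ (j + 1) := by
      rw [div_le_iff₀ hpos]
      refine hball.trans_eq ?_
      ring
    have h8 : (1 / 10 : ℝ) ^ j ≤ (1 / 8) ^ j := pow_le_pow_left₀ (by norm_num) (by norm_num) j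
    have h52 : (1 / 52 : ℝ) ^ j ≤ (1 / 8) ^ j := pow_le_pow_left₀ (by norm_num) (by norm_num) j
    have e52 : (2 : ℝ) / 52 ^ (j + 1) = 2 / 52 * (1 / 52) ^ j := by
      rw [pow_succ, one_div, inv_pow]
      field_simp
    have := ih (by omega)
    rw [e52] at hratio
    rw [pow_succ (1 / 10 : ℝ)] at hstep
    rw [pow_succ (1 / 8 : ℝ)]
    have hnn : (0 : ℝ) ≤ (1 / 8) ^ j := by positivity
    -- The step closes because 3·2/52 + 1/10 ≤ 7/32 = (1/4)(1 - 1/8).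
    linarith

/-- For some first column, every nonzero codeword has weight larger than `w`. -/
lemma exists_good_column {p m : ℕ} [NeZero p] (hp : IsKasamiPrime p) (hp' : 2744 ≤ p) {w : ℝ}
    (h : (#(ball (ZMod (p ^ m) ⊕ ZMod (p ^ m)) w) : ℝ) ≤ 0.23 * (p ^ m : ℕ) * 2 ^ p ^ m) :
    ∃ a : ZMod (p ^ m) → ZMod 2, ∀ v, InCode a v → v ≠ 0 → w < hammingNorm v := by
  have hn1 : (0 : ℝ) < (p ^ m : ℕ) := by exact_mod_cast NeZero.pos (p ^ m)
  suffices hbad : #(badColumns (p ^ m) w) < 2 ^ p ^ m by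
    have hne : badColumns (p ^ m) w ≠ univ := by
      intro heq
      rw [heq, card_univ, Fintype.card_fun, ZMod.card, ZMod.card] at hbad
      exact lt_irrefl _ hbad
    obtain ⟨a, ha⟩ : ∃ a, a ∉ badColumns (p ^ m) w := by
      by_contra! hall
      exact hne (Finset.eq_univ_iff_forall.2 hall)
    refine ⟨a, fun v hv hv0 => ?_⟩
    by_contra! hle
    exact ha (mem_badColumns.2 ⟨v, mem_ball.2 ⟨hv0, hle⟩, hv⟩)
  rcases m with _ | m
  · rw [badColumns_one_eq_empty]
    · rw [card_empty]
      positivity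
    -- At length 1, a radius of at least 1 would put at least 2 vectors in the ball, against the
    -- bound 0.46.
    · by_contra! hw
      have h1 := choose_le_card_ball (I := ZMod (p ^ 0) ⊕ ZMod (p ^ 0)) one_ne_zero
        (by simpa using hw)
      rw [card_zmod_sum] at h1
      have h2 : (2 : ℝ) ≤ #(ball (ZMod (p ^ 0) ⊕ ZMod (p ^ 0)) w) := by
        exact_mod_cast le_trans (by simp) h1
      have h3 : ((p ^ 0 : ℕ) : ℝ) = 1 := by simp
      have h4 : (2 : ℝ) ^ p ^ 0 = 2 := by simp
      rw [h3, h4] at h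
      linarith
  · have hle : (#(ball (ZMod (p ^ (m + 1)) ⊕ ZMod (p ^ (m + 1))) w) : ℝ) ≤
        (p ^ (m + 1) : ℕ) * 2 ^ p ^ (m + 1) := by
      refine h.trans ?_
      have : (0 : ℝ) ≤ (p ^ (m + 1) : ℕ) * 2 ^ p ^ (m + 1) := by positivity
      rw [mul_assoc]
      linarith
    have hw := le_quarter_of_card_ball_le (hp'.trans (Nat.le_self_pow (by omega) p)) hle
    have hstep := card_badColumns_succ_le hp hp' hw
    have hrest := card_badColumns_le hp hp' hle hw m.lt_succ_self
    rw [show m.succ - m = 1 by omega, pow_one] at hrest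
    have hratio : (#(ball (ZMod (p ^ (m + 1)) ⊕ ZMod (p ^ (m + 1))) w) : ℝ) /
        ((p ^ (m + 1) : ℕ) * 2 ^ p ^ (m + 1)) ≤ 23 / 100 := by
      rw [div_le_iff₀ (by positivity), ← mul_assoc]
      refine h.trans_eq ?_
      norm_num
    have h8 : (1 / 10 : ℝ) ^ m ≤ (1 / 8) ^ m := pow_le_pow_left₀ (by norm_num) (by norm_num) m
    have hnn : (0 : ℝ) ≤ (1 / 8) ^ m := by positivity
    rw [pow_succ (1 / 10 : ℝ)] at hstep
    have hlt : (#(badColumns (p ^ (m + 1)) w) : ℝ) / 2 ^ p ^ (m + 1) < 1 := by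
      -- Here 3·0.23 + 1/4 = 0.94, and (1/10)^(m+1) is absorbed by the term -(1/4)(1/8)^m.
      linarith
    rw [div_lt_one (by positivity)] at hlt
    exact_mod_cast hlt

/-! ### The code attached to a first column -/

/-- The double circulant code with parity-check matrix `[I | circulant a]`. -/
def columnCode {n : ℕ} (a : Fin n → ZMod 2) : Submodule (ZMod 2) (V n) :=
  LinearMap.ker (parityCheck a).mulVecLin

lemma mem_columnCode {n : ℕ} {a : Fin n → ZMod 2} {x : V n} :
    x ∈ columnCode a ↔ (parityCheck a).mulVec x = 0 := by
  rw [columnCode, LinearMap.mem_ker, Matrix.mulVecLin_apply]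

lemma sum_eq_zero_of_mem_columnCode {n : ℕ} {a : Fin n → ZMod 2} {x : V n}
    (hx : x ∈ columnCode a) (i : Fin n) :
    x (.inl i) + ∑ j, a (i - j) * x (.inr j) = 0 := by
  have h := congrFun (mem_columnCode.1 hx) i
  rw [parityCheck, Matrix.fromCols_mulVec, Matrix.one_mulVec] at h
  exact h

lemma isDoubleCirculant_columnCode {n : ℕ} (a : Fin n → ZMod 2) :
    IsDoubleCirculant (columnCode a) :=
  ⟨a, fun _ => mem_columnCode⟩

lemma finrank_columnCode {n : ℕ} (a : Fin n → ZMod 2) :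
    Module.finrank (ZMod 2) (columnCode a) = n := by
  have hsurj : LinearMap.range (parityCheck a).mulVecLin = ⊤ := by
    rw [LinearMap.range_eq_top]
    intro y
    refine ⟨Sum.elim y 0, ?_⟩
    rw [Matrix.mulVecLin_apply, parityCheck, Matrix.fromCols_mulVec]
    simp
  have h := LinearMap.finrank_range_add_finrank_ker (parityCheck a).mulVecLin
  rw [hsurj, finrank_top, Module.finrank_fin_fun, Module.finrank_fintype_fun_eq_card,
    Fintype.card_sum, Fintype.card_fin] at h
  exact Nat.add_left_cancel h

lemma exists_hasParameters {n : ℕ} (hn : n ≠ 0) {w : ℝ} {C : Submodule (ZMod 2) (V n)}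
    (hC : Module.finrank (ZMod 2) C = n) (h : ∀ x ∈ C, x ≠ 0 → w < hammingNorm x) :
    ∃ d : ℕ, HasParameters C n d ∧ w < d := by
  set S := {k : ℕ | ∃ x ∈ C, ∃ y ∈ C, x ≠ y ∧ hammingDist x y = k} with hS
  have hne : S.Nonempty := by
    have hbot : C ≠ ⊥ := by
      rintro rfl
      rw [finrank_bot] at hC
      exact hn hC.symm
    obtain ⟨x, hx, hx0⟩ := Submodule.exists_mem_ne_zero_of_ne_bot hbot
    exact ⟨_, x, hx, 0, C.zero_mem, hx0, rfl⟩
  refine ⟨sInf S, ⟨hC, Nat.sInf_mem hne, fun k hk => Nat.sInf_le hk⟩, ?_⟩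
  obtain ⟨x, hx, y, hy, hxy, hd⟩ := Nat.sInf_mem hne
  rw [← hd, hammingDist_eq_hammingNorm]
  exact h _ (C.add_mem (C.neg_mem hx) hy) fun h0 => hxy (neg_add_eq_zero.1 h0)

lemma ncard_B (n : ℕ) [NeZero n] (w : ℝ) : (B n w).ncard = #(ball (ZMod n ⊕ ZMod n) w) := by
  obtain ⟨k, rfl⟩ := Nat.exists_eq_succ_of_ne_zero (NeZero.ne n)
  have h : B (k + 1) w = ↑(ball (Fin (k + 1) ⊕ Fin (k + 1)) w) := by
    ext x
    rw [mem_coe, mem_ball]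
    rfl
  rw [h, Set.ncard_coe_finset]
  exact card_ball_congr (Equiv.refl _) w

lemma exists_column (n : ℕ) [NeZero n] {w : ℝ}
    (h : ∃ a : ZMod n → ZMod 2, ∀ v, InCode a v → v ≠ 0 → w < hammingNorm v) :
    ∃ a : Fin n → ZMod 2, ∀ x ∈ columnCode a, x ≠ 0 → w < hammingNorm x := by
  obtain ⟨k, rfl⟩ := Nat.exists_eq_succ_of_ne_zero (NeZero.ne n)
  obtain ⟨a, ha⟩ := h
  exact ⟨a, fun x hx hx0 => ha x (fun i => sum_eq_zero_of_mem_columnCode hx i) hx0⟩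

end DoubleCirculant

theorem mainTheorem2 :
    (∀ b : ℝ, 0 < b → b ≤ 0.23 →
      ∀ p : ℕ, DoubleCirculant.IsKasamiPrime p → 14 ^ 3 ≤ p →
        ∀ m n : ℕ, n = p ^ m →
          ∀ w : ℝ, ((DoubleCirculant.B n w).ncard : ℝ) ≤ b * n * 2 ^ n →
            ∃ C : Submodule (ZMod 2) (DoubleCirculant.V n),
              DoubleCirculant.IsDoubleCirculant C ∧
                ∃ d : ℕ, DoubleCirculant.HasParameters C n d ∧ w < d) ∧
    IsLeast {p : ℕ | DoubleCirculant.IsKasamiPrime p ∧ 14 ^ 3 ≤ p} 2789 := by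
  refine ⟨?_, DoubleCirculant.isLeast_kasamiPrime⟩
  rintro b - hb p hp hp14 m n rfl w hB
  have : NeZero p := ⟨hp.1.ne_zero⟩
  rw [DoubleCirculant.ncard_B] at hB
  have hball : ((DoubleCirculant.ball (ZMod (p ^ m) ⊕ ZMod (p ^ m)) w).card : ℝ) ≤
      0.23 * (p ^ m : ℕ) * 2 ^ p ^ m := hB.trans (by gcongr)
  obtain ⟨a, ha⟩ := DoubleCirculant.exists_column (p ^ m)
    (DoubleCirculant.exists_good_column hp (le_trans (by norm_num) hp14) hball)
  exact ⟨DoubleCirculant.columnCode a, DoubleCirculant.isDoubleCirculant_columnCode a,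
    DoubleCirculant.exists_hasParameters (NeZero.ne (p ^ m))
      (DoubleCirculant.finrank_columnCode a) ha⟩
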